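/- Let $n\ge 3$, $d=n+1$, and let $M$ be a compact smooth $d$-manifold with (possibly empty) boundary $\Sigma=\partial M$; all metrics are smooth up to the boundary and positive definite. A *defining function* is a smooth $x\ge 0$ on $M$ with zero set $\Sigma$ and $dx\neq 0$ along $\Sigma$. A pair $(g,x)$ of a metric and a defining function is *Poincaré–Einstein* if $g_+:=x^{-2}g$ satisfies $\mathrm{Ric}(g_+)=-n\,g_+$ on $M\setminus\Sigma$. For a conformal class $c=[g]$ let $\mathcal E[w]$ be the bundle of conformal densities of weight $w$ (functions $f_g$, $g\in c$, with $f_{e^{2\omega}g}=e^{w\omega}f_g$), $\boldsymbol g$ the conformal metric, $P_{ab}$ the Schouten tensor ($\mathrm{Ric}=(d-2)P+Jg$, $J=\operatorname{tr}_g P$), and $\mathcal T$ the standard tractor bundle. In a scale $g\in c$ a tractor is a triple $I=(\sigma,\mu_a,\rho)\in\mathcal E[1]\oplus\mathcal E_a[1]\oplus\mathcal E[-1]$; under $g\mapsto e^{2\omega}g$, with $\Upsilon=d\omega$, it changes to $(\sigma,\ \mu_a+\Upsilon_a\sigma,\ \rho-\Upsilon^a\mu_a-\tfrac12\Upsilon^a\Upsilon_a\sigma)$.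 The tractor metric is $|I|^2=2\rho\sigma+\mu^a\mu_a$, and the tractor connection is $\nabla_a I=(\nabla_a\sigma-\mu_a,\ \nabla_a\mu_b+\boldsymbol g_{ab}\rho+P_{ab}\sigma,\ \nabla_a\rho-P_{ac}\mu^c)$. An *almost Einstein structure* $(M,c,I)$ is a conformal manifold with a parallel smooth standard tractor $I\ne 0$ (if $M$ is disconnected: $I\not\equiv0$ on each component). Its *scale* is the top slot $\sigma\in\mathcal E[1]$ of $I$, its *scale singularity set* is the zero set of $\sigma$; off this set $g_+:=\sigma^{-2}\boldsymbol g$ is a metric. It is *scalar negative* if $g_+$ has negative scalar curvature there. 1. If $(g,x)$ is Poincaré–Einstein, then there is a tractor $I$ for $c=[g]$ such that $(M,[g],I)$ is a scalar negative almost Einstein structure with $|I|^2=1$, with scale $\sigma=x\tau$, where $\tau\in\mathcal E[1]$ is positive and $g=\tau^{-2}\boldsymbol g$. In particular the scale singularity set is $\Sigma$ and $\sigma^{-2}\boldsymbol g=x^{-2}g$ on $M\setminus\Sigma$. Moreover $|dx|_g=1$ along $\Sigma$. 2. If $(M,c,I)$ is an almost Einstein structure on $M$ with scale singularity set $\Sigma$,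 then $|I|^2=1$ on $M$ if and only if $\mathrm{Ric}(g_+)=-n\,g_+$ on $M\setminus\Sigma$, where $g_+=\sigma^{-2}\boldsymbol g$. 3. Conversely, let $(M,c,I)$ be an almost Einstein structure on $M$ with $|I|^2=1$ and scale singularity set $\Sigma$. Then for every metric $g\in c$ there is a nowhere vanishing $\tau\in\mathcal E[1]$ with $g=\tau^{-2}\boldsymbol g$ such that $x:=\sigma/\tau$ is smooth, $(g,x)$ is Poincaré–Einstein with $x^{-2}g=\sigma^{-2}\boldsymbol g$ on $M\setminus\Sigma$, and $x$ is a special defining function: it is a defining function with $|dx|_g=1$ along $\Sigma$. -/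

import Mathlib

open scoped Manifold ContDiff Bundle

noncomputable section

namespace ConformalGeometry

/-! ## Coordinate formulas

Local Riemannian geometry on the closed half space `{y | 0 ≤ y 0}` of `ℝ^(n+1)`: a metric, or a
tensor, is given by its matrix of component functions. Derivatives are taken within the half space,
so that the formulas make sense up to the boundary (at interior points this is the usual
derivative). -/

/-- The coordinate space `ℝ^(n+1)`. -/
abbrev Coord (n : ℕ) : Type := EuclideanSpace ℝ (Fin (n + 1))

/-- The partial derivative `∂_i f` at `y`, taken within the closed half space. -/
def pd {n : ℕ} (i : Fin (n + 1)) (f : Coord n → ℝ) (y : Coord n) : ℝ :=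
  fderivWithin ℝ f (Set.range (𝓡∂ (n + 1))) y (EuclideanSpace.single i 1)

/-- The Christoffel symbol `Γ^k_{ij}` of the Levi-Civita connection of the metric `G`. -/
def christoffel {n : ℕ} (G : Coord n → Matrix (Fin (n + 1)) (Fin (n + 1)) ℝ)
    (k i j : Fin (n + 1)) (y : Coord n) : ℝ :=
  (1 / 2) * ∑ l, (G y)⁻¹ k l *
    (pd i (fun z => G z j l) y + pd j (fun z => G z i l) y - pd l (fun z => G z i j) y)

/-- The Riemann tensor `R_{ab}{}^c{}_e`, normalised by
`(∇_a ∇_b - ∇_b ∇_a) V^c = R_{ab}{}^c{}_e V^e`. -/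
def riemann {n : ℕ} (G : Coord n → Matrix (Fin (n + 1)) (Fin (n + 1)) ℝ)
    (a b c e : Fin (n + 1)) (y : Coord n) : ℝ :=
  pd a (christoffel G c b e) y - pd b (christoffel G c a e) y
    + ∑ f, (christoffel G c a f y * christoffel G f b e y
      - christoffel G c b f y * christoffel G f a e y)

/-- The Ricci tensor `Ric_{ab} = R_{ca}{}^c{}_b`. -/
def ricci {n : ℕ} (G : Coord n → Matrix (Fin (n + 1)) (Fin (n + 1)) ℝ) (y : Coord n) :
    Matrix (Fin (n + 1)) (Fin (n + 1)) ℝ :=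
  Matrix.of fun a b => ∑ c, riemann G c a c b y

/-- The scalar curvature, the metric trace of the Ricci tensor. -/
def scal {n : ℕ} (G : Coord n → Matrix (Fin (n + 1)) (Fin (n + 1)) ℝ) (y : Coord n) : ℝ :=
  ∑ a, ∑ b, (G y)⁻¹ a b * ricci G y a b

/-- The Schouten tensor `P` in dimension `d = n + 1`, determined by `Ric = (d - 2) P + J g` with
`J` the metric trace of `P`, that is `J = Scal / (2 (d - 1))` and
`P = (Ric - J g) / (d - 2)`. -/
def schouten {n : ℕ} (G : Coord n → Matrix (Fin (n + 1)) (Fin (n + 1)) ℝ) (y : Coord n) :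
    Matrix (Fin (n + 1)) (Fin (n + 1)) ℝ :=
  ((n : ℝ) - 1)⁻¹ • (ricci G y - (scal G y / (2 * (n : ℝ))) • G y)

/-! ## Metrics and tensors on a manifold with boundary -/

section Manifold

variable (n : ℕ) (M : Type*) [TopologicalSpace M] [ChartedSpace (EuclideanHalfSpace (n + 1)) M]
  [IsManifold (𝓡∂ (n + 1)) ∞ M]

/-- Smooth Riemannian metrics on the `(n+1)`-manifold with boundary `M` (smooth up to the
boundary). -/
abbrev Metric : Type _ :=
  Bundle.ContMDiffRiemannianMetric (𝓡∂ (n + 1)) ∞ (Coord n)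
    (fun p : M => TangentSpace (𝓡∂ (n + 1)) p)

/-- Smooth real functions on `M` (smooth up to the boundary). -/
abbrev SmoothFun : Type _ := C^∞⟮𝓡∂ (n + 1), M; 𝓘(ℝ, ℝ), ℝ⟯

/-- Fields of bilinear forms on the tangent spaces, with no regularity assumption. -/
abbrev BilinField : Type _ :=
  ∀ p : M, TangentSpace (𝓡∂ (n + 1)) p →L[ℝ] TangentSpace (𝓡∂ (n + 1)) p →L[ℝ] ℝ

/-- Smooth one-forms on `M`, i.e. smooth sections of the cotangent bundle. -/
abbrev OneForm : Type _ :=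
  Cₛ^∞⟮𝓡∂ (n + 1); Coord n →L[ℝ] ℝ, fun p : M => TangentSpace (𝓡∂ (n + 1)) p →L[ℝ] ℝ⟯

variable {n M}

/-- The differential `df` at `p`, as a covector. -/
def dAt (f : SmoothFun n M) (p : M) : TangentSpace (𝓡∂ (n + 1)) p →L[ℝ] ℝ :=
  mfderiv (𝓡∂ (n + 1)) 𝓘(ℝ, ℝ) f p

/-- The musical isomorphism `v ↦ g(v, ·)` at `p`. -/
def flat (g : Metric n M) (p : M) :
    TangentSpace (𝓡∂ (n + 1)) p ≃ₗ[ℝ] Module.Dual ℝ (TangentSpace (𝓡∂ (n + 1)) p) :=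
  haveI : FiniteDimensional ℝ (TangentSpace (𝓡∂ (n + 1)) p) :=
    inferInstanceAs (FiniteDimensional ℝ (Coord n))
  LinearMap.linearEquivOfInjective
    ((ContinuousLinearMap.coeLM ℝ).comp (g.inner p).toLinearMap)
    (by
      refine (injective_iff_map_eq_zero _).2 fun v hv => ?_
      by_contra h
      have h1 := g.pos p v h
      have h2 : g.inner p v v = 0 := congrArg (fun f => f v) hv
      exact h1.ne' h2)
    Subspace.dual_finrank_eq.symm

/-- The inner product `g^{ab} α_a β_b` of two covectors at `p`. -/
def cometric (g : Metric n M) (p : M) (α β : TangentSpace (𝓡∂ (n + 1)) p →L[ℝ] ℝ) : ℝ :=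
  α ((flat g p).symm β.toLinearMap)

theorem flat_symm_apply (g : Metric n M) (p : M)
    (α : Module.Dual ℝ (TangentSpace (𝓡∂ (n + 1)) p)) (w : TangentSpace (𝓡∂ (n + 1)) p) :
    g.inner p ((flat g p).symm α) w = α w :=
  congrArg (fun f => f w) ((flat g p).apply_symm_apply α)

/-- The coordinate vector field `∂_i` of the chart `φ`, at the point with coordinates `y`. -/
def coordVec (φ : OpenPartialHomeomorph M (EuclideanHalfSpace (n + 1))) (i : Fin (n + 1))
    (y : Coord n) : TangentSpace (𝓡∂ (n + 1)) ((φ.extend (𝓡∂ (n + 1))).symm y) :=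
  mfderivWithin 𝓘(ℝ, Coord n) (𝓡∂ (n + 1)) (φ.extend (𝓡∂ (n + 1))).symm
    (Set.range (𝓡∂ (n + 1))) y (EuclideanSpace.single i (1 : ℝ) : Coord n)

/-- The components `T(∂_i, ∂_j)` of a field of bilinear forms in the chart `φ`. -/
def comp₂ (φ : OpenPartialHomeomorph M (EuclideanHalfSpace (n + 1))) (T : BilinField n M)
    (y : Coord n) : Matrix (Fin (n + 1)) (Fin (n + 1)) ℝ :=
  Matrix.of fun i j => T ((φ.extend (𝓡∂ (n + 1))).symm y) (coordVec φ i y) (coordVec φ j y)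

/-- The components `α(∂_i)` of a one-form in the chart `φ`. -/
def comp₁ (φ : OpenPartialHomeomorph M (EuclideanHalfSpace (n + 1))) (α : OneForm n M)
    (i : Fin (n + 1)) (y : Coord n) : ℝ :=
  α ((φ.extend (𝓡∂ (n + 1))).symm y) (coordVec φ i y)

/-- A function read in the chart `φ`. -/
def comp₀ (φ : OpenPartialHomeomorph M (EuclideanHalfSpace (n + 1))) (f : M → ℝ)
    (y : Coord n) : ℝ :=
  f ((φ.extend (𝓡∂ (n + 1))).symm y)

/-- `P φ y` holds for every chart `φ` of the maximal smooth atlas and all coordinates `y` in the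
image of `φ` of a point of `U`. Used for equations between tensors, written in components. -/
def InAllCharts (U : Set M)
    (P : OpenPartialHomeomorph M (EuclideanHalfSpace (n + 1)) → Coord n → Prop) : Prop :=
  ∀ φ ∈ IsManifold.maximalAtlas (𝓡∂ (n + 1)) ∞ M, ∀ y ∈ (φ.extend (𝓡∂ (n + 1))).target,
    (φ.extend (𝓡∂ (n + 1))).symm y ∈ U → P φ y

/-- `Ric(T) = c T` on the set `U`, for a metric tensor `T` that is smooth near the points of `U`. -/
def RicciEqOn (T : BilinField n M) (c : ℝ) (U : Set M) : Prop :=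
  InAllCharts U fun φ y => ricci (comp₂ φ T) y = c • comp₂ φ T y

/-- `T` has negative scalar curvature on `U`. -/
def ScalNegOn (T : BilinField n M) (U : Set M) : Prop :=
  InAllCharts U fun φ y => scal (comp₂ φ T) y < 0

/-! ## Conformal structures, densities, tractors -/

/-- `g' = e^{2u} g`. -/
def IsRescaling (g g' : Metric n M) (u : SmoothFun n M) : Prop :=
  ∀ (p : M) (v w : TangentSpace (𝓡∂ (n + 1)) p),
    g'.inner p v w = Real.exp (2 * u p) * g.inner p v w

variable (n M) in
/-- Conformal equivalence of metrics. -/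
def conformalSetoid : Setoid (Metric n M) where
  r g g' := ∃ u : SmoothFun n M, IsRescaling g g' u
  iseqv :=
    { refl := fun g => ⟨0, fun p v w => by simp⟩
      symm := by
        rintro g g' ⟨u, h⟩
        refine ⟨-u, fun p v w => ?_⟩
        have e : (-u : SmoothFun n M) p = -(u p) := rfl
        rw [h p v w, e, ← mul_assoc, ← Real.exp_add]
        ring_nf
        simp
      trans := by
        rintro g g' g'' ⟨u, h⟩ ⟨u', h'⟩
        refine ⟨u + u', fun p v w => ?_⟩
        have e : (u + u' : SmoothFun n M) p = u p + u' p := rfl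
        rw [h' p v w, h p v w, e, ← mul_assoc, ← Real.exp_add]
        ring_nf }

variable (n M) in
/-- Conformal structures on `M`: conformal classes of metrics. -/
def ConformalStructure : Type _ := Quotient (conformalSetoid n M)

/-- The conformal class `[g]`. -/
def conformalClass (g : Metric n M) : ConformalStructure n M :=
  Quotient.mk (conformalSetoid n M) g

/-- The scales of a conformal structure: the metrics in the conformal class. -/
def Scale (c : ConformalStructure n M) : Type _ := {g : Metric n M // conformalClass g = c}

/-- Some scale of the conformal structure. -/
def someScale (c : ConformalStructure n M) : Scale c := ⟨Quotient.out c, Quotient.out_eq c⟩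

theorem Scale.exists_rescaling {c : ConformalStructure n M} (g g' : Scale c) :
    ∃ u : SmoothFun n M, IsRescaling g.1 g'.1 u :=
  Quotient.exact (s := conformalSetoid n M) (g.2.trans g'.2.symm)

/-- Smooth conformal densities of weight `w`, i.e. sections of `E[w]`. Each scale trivialises
`E[w]`, so a density is a function in every scale, and under `g' = e^{2u} g` it changes by
`e^{w u}`. -/
structure Density (c : ConformalStructure n M) (w : ℝ) where
  /-- The function that represents the density in a given scale. -/
  inScale : Scale c → SmoothFun n M
  transform : ∀ (g g' : Scale c) (u : SmoothFun n M), IsRescaling g.1 g'.1 u →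
    ∀ p, inScale g' p = Real.exp (w * u p) * inScale g p

/-- Smooth sections of the standard tractor bundle. In each scale `g` the bundle is the direct sum
`E[1] ⊕ E_a[1] ⊕ E[-1]`, and the densities are functions, so that a section is a triple
`(σ, μ_a, ρ)`. Under `g' = e^{2u} g`, with `Υ = du`, the triple changes to
`(σ, μ_a + Υ_a σ, ρ - g^{ab} Υ_a μ_b - (1/2) g^{ab} Υ_a Υ_b σ)` as densities, hence with the
factors `e^u`, `e^u`, `e^{-u}` for the weights `1`, `1`, `-1`. -/
structure Tractor (c : ConformalStructure n M) where
  /-- The slot `σ ∈ E[1]`. -/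
  top : Scale c → SmoothFun n M
  /-- The slot `μ_a ∈ E_a[1]`. -/
  mid : Scale c → OneForm n M
  /-- The slot `ρ ∈ E[-1]`. -/
  bot : Scale c → SmoothFun n M
  transform_top : ∀ (g g' : Scale c) (u : SmoothFun n M), IsRescaling g.1 g'.1 u →
    ∀ p, top g' p = Real.exp (u p) * top g p
  transform_mid : ∀ (g g' : Scale c) (u : SmoothFun n M), IsRescaling g.1 g'.1 u →
    ∀ p, mid g' p = Real.exp (u p) • (mid g p + top g p • dAt u p)
  transform_bot : ∀ (g g' : Scale c) (u : SmoothFun n M), IsRescaling g.1 g'.1 u →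
    ∀ p, bot g' p = Real.exp (-(u p)) * (bot g p - cometric g.1 p (dAt u p) (mid g p)
      - (1 / 2) * cometric g.1 p (dAt u p) (dAt u p) * top g p)

/-- The metric tensor `σ^{-2} 𝐠` determined by a density `σ` of weight one, where `𝐠` is the
conformal metric: in any scale `g` it is `σ^{-2} g`, see `Density.metric_eq`. It is a metric where
`σ ≠ 0`; where `σ = 0` it has the junk value `0`. -/
def Density.metric {c : ConformalStructure n M} (σ : Density c 1) : BilinField n M :=
  fun p => ((σ.inScale (someScale c) p) ^ 2)⁻¹ • (someScale c).1.inner p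

theorem Density.metric_eq {c : ConformalStructure n M} (σ : Density c 1) (g : Scale c) (p : M) :
    σ.metric p = ((σ.inScale g p) ^ 2)⁻¹ • g.1.inner p := by
  obtain ⟨u, h⟩ := Scale.exists_rescaling (someScale c) g
  ext v w
  have e := h p v w
  have hE : Real.exp (2 * u p) = Real.exp (u p) ^ 2 := by
    rw [← Real.exp_nat_mul]; norm_num
  have hne : Real.exp (u p) ≠ 0 := (Real.exp_pos _).ne'
  simp only [Density.metric, smul_apply, smul_eq_mul]
  rw [e, σ.transform _ _ u h p, one_mul, hE, mul_pow, mul_inv]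
  field_simp

/-- The set where a density vanishes. -/
def Density.zeroSet {c : ConformalStructure n M} {w : ℝ} (σ : Density c w) : Set M :=
  {p | ∀ g : Scale c, σ.inScale g p = 0}

/-- A tractor is zero at `p` if its triple vanishes at `p` in (every) scale. -/
def Tractor.VanishesAt {c : ConformalStructure n M} (I : Tractor c) (p : M) : Prop :=
  ∀ g : Scale c, I.top g p = 0 ∧ I.mid g p = 0 ∧ I.bot g p = 0

/-- The scale `σ = h(X, I)`: the top slot, a density of weight one. -/
def Tractor.scale {c : ConformalStructure n M} (I : Tractor c) : Density c 1 where
  inScale := I.top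
  transform := by simpa using I.transform_top

/-- The tractor metric `h(I, I) = 2 ρ σ + g^{ab} μ_a μ_b`, computed in some scale. It does not
depend on the scale, see `Tractor.normSq_eq`. -/
def Tractor.normSq {c : ConformalStructure n M} (I : Tractor c) (p : M) : ℝ :=
  2 * I.bot (someScale c) p * I.top (someScale c) p
    + cometric (someScale c).1 p (I.mid (someScale c) p) (I.mid (someScale c) p)

theorem cometric_rescaling {g g' : Metric n M} {u : SmoothFun n M} (h : IsRescaling g g' u) (p : M)
    (α β : TangentSpace (𝓡∂ (n + 1)) p →L[ℝ] ℝ) :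
    cometric g' p α β = Real.exp (-(2 * u p)) * cometric g p α β := by
  have key : (flat g' p).symm β.toLinearMap
      = Real.exp (-(2 * u p)) • (flat g p).symm β.toLinearMap := by
    rw [LinearEquiv.symm_apply_eq]
    ext w
    change β w = g'.inner p (Real.exp (-(2 * u p)) • (flat g p).symm β.toLinearMap) w
    rw [h p, map_smul, smul_apply, flat_symm_apply, smul_eq_mul, ← mul_assoc,
      ← Real.exp_add]
    simp
  simp only [cometric]
  rw [key, map_smul, smul_eq_mul]

theorem cometric_comm (g : Metric n M) (p : M) (α β : TangentSpace (𝓡∂ (n + 1)) p →L[ℝ] ℝ) :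
    cometric g p α β = cometric g p β α := by
  have h1 := flat_symm_apply g p α.toLinearMap ((flat g p).symm β.toLinearMap)
  have h2 := flat_symm_apply g p β.toLinearMap ((flat g p).symm α.toLinearMap)
  exact h1.symm.trans ((g.symm p _ _).trans h2)

theorem Tractor.normSq_eq {c : ConformalStructure n M} (I : Tractor c) (g : Scale c) (p : M) :
    I.normSq p = 2 * I.bot g p * I.top g p + cometric g.1 p (I.mid g p) (I.mid g p) := by
  obtain ⟨u, h⟩ := Scale.exists_rescaling (someScale c) g
  have hm := I.transform_mid _ _ u h p
  rw [I.transform_top _ _ u h p, I.transform_bot _ _ u h p, cometric_rescaling h, hm, Tractor.normSq]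
  generalize (I.mid (someScale c)) p = μ
  generalize I.top (someScale c) p = s
  generalize I.bot (someScale c) p = r
  generalize dAt u p = υ
  have hc := cometric_comm (someScale c).1 p μ υ
  have expand : cometric (someScale c).1 p (Real.exp (u p) • (μ + s • υ))
      (Real.exp (u p) • (μ + s • υ)) = Real.exp (u p) ^ 2 *
      (cometric (someScale c).1 p μ μ + s * cometric (someScale c).1 p μ υ
        + s * cometric (someScale c).1 p υ μ + s ^ 2 * cometric (someScale c).1 p υ υ) := by
    simp only [cometric, ContinuousLinearMap.toLinearMap_smul, ContinuousLinearMap.toLinearMap_add,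
      map_smul, map_add, smul_apply, add_apply, smul_eq_mul]
    ring
  rw [expand, hc]
  have e1 : Real.exp (-(2 * u p)) * Real.exp (u p) ^ 2 = 1 := by
    rw [← Real.exp_nat_mul, ← Real.exp_add]; simp
  have e2 : Real.exp (-(u p)) * Real.exp (u p) = 1 := by
    rw [← Real.exp_add]; simp
  linear_combination (-(cometric (someScale c).1 p μ μ + 2 * s * cometric (someScale c).1 p υ μ
    + s ^ 2 * cometric (someScale c).1 p υ υ)) * e1
    - 2 * s * (r - cometric (someScale c).1 p υ μ
      - 1 / 2 * cometric (someScale c).1 p υ υ * s) * e2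

/-- The tractor connection annihilates `I`. In every scale `g`, the three slots of `∇_a I`,
`∇_a σ - μ_a`, `∇_a μ_b + g_{ab} ρ + P_{ab} σ`, `∇_a ρ - P_{ac} μ^c`, vanish. -/
def Tractor.IsParallel {c : ConformalStructure n M} (I : Tractor c) : Prop :=
  ∀ g : Scale c, InAllCharts (Set.univ : Set M) fun φ y =>
    (∀ a, pd a (comp₀ φ (I.top g)) y - comp₁ φ (I.mid g) a y = 0) ∧
    (∀ a b, pd a (comp₁ φ (I.mid g) b) y
        - ∑ e, christoffel (comp₂ φ g.1.inner) e a b y * comp₁ φ (I.mid g) e y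
      + comp₂ φ g.1.inner y a b * comp₀ φ (I.bot g) y
      + schouten (comp₂ φ g.1.inner) y a b * comp₀ φ (I.top g) y = 0) ∧
    (∀ a, pd a (comp₀ φ (I.bot g)) y
      - ∑ b, ∑ e, schouten (comp₂ φ g.1.inner) y a b * (comp₂ φ g.1.inner y)⁻¹ b e
          * comp₁ φ (I.mid g) e y = 0)

/-- `(M, c, I)` is an almost Einstein structure: `I` is a nonzero parallel standard tractor. Being
parallel, `I` vanishes either everywhere or nowhere on each connected component of `M`; it is
required not to vanish identically on any component. -/
def Tractor.IsAlmostEinstein {c : ConformalStructure n M} (I : Tractor c) : Prop :=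
  I.IsParallel ∧ ∀ p, ∃ q ∈ connectedComponent p, ¬ I.VanishesAt q

/-- The scale singularity set: the zero set of `σ = h(X, I)`. -/
def Tractor.singularSet {c : ConformalStructure n M} (I : Tractor c) : Set M := I.scale.zeroSet

/-- The almost Einstein structure is scalar negative: the metric `g₊ = σ^{-2} 𝐠` has
negative scalar curvature off the scale singularity set. -/
def Tractor.IsScalarNegative {c : ConformalStructure n M} (I : Tractor c) : Prop :=
  ScalNegOn I.scale.metric I.singularSetᶜ

/-! ## Poincaré–Einstein structures -/

/-- `x` is a (non-negative, smooth) defining function for the boundary: its zero set is the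
boundary, and `dx` does not vanish there. -/
structure IsDefiningFunction (x : SmoothFun n M) : Prop where
  nonneg : ∀ p, 0 ≤ x p
  zero_iff : ∀ p, x p = 0 ↔ p ∈ (𝓡∂ (n + 1)).boundary M
  d_ne_zero : ∀ p ∈ (𝓡∂ (n + 1)).boundary M, dAt x p ≠ 0

/-- `x` is a special defining function relative to `g`: moreover `|dx|_g = 1` along the
boundary. -/
def IsSpecialDefiningFunction (g : Metric n M) (x : SmoothFun n M) : Prop :=
  IsDefiningFunction x ∧
    ∀ p ∈ (𝓡∂ (n + 1)).boundary M, cometric g p (dAt x p) (dAt x p) = 1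

/-- The metric `g₊ = x^{-2} g`, meaningful where `x ≠ 0`. -/
def interiorMetric (g : Metric n M) (x : SmoothFun n M) : BilinField n M :=
  fun p => ((x p) ^ 2)⁻¹ • g.inner p

/-- `(M, g)` with the defining function `x` is Poincaré–Einstein: `g₊ = x^{-2} g` satisfies
`Ric(g₊) = -n g₊` on the interior of `M`. (Compactness of `M` is assumed where this is used.) -/
structure IsPoincareEinstein (g : Metric n M) (x : SmoothFun n M) : Prop where
  defining : IsDefiningFunction x
  einstein : RicciEqOn (interiorMetric g x) (-(n : ℝ)) ((𝓡∂ (n + 1)).boundary M)ᶜ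

end Manifold

end ConformalGeometry

end

open ConformalGeometry

/-! In a chart write `G` for the metric, `s` for the scale, `P` for the Schouten tensor and `J` for
its trace. The Ricci tensor of `s⁻² G` is `Ric + (n-1) s⁻¹ ∇∇s + (s⁻¹ Δs - n s⁻² |ds|²) G`
(`IsCoordMetric.ricci_conformal`). Since `Ric = (n-1) P + J G`, the metric `s⁻² G` is Einstein
exactly when `∇∇s + P s` is pure trace, say `-ρ G`; taking the trace gives `ρ = -(Δs + J s)/d`, and
the Einstein constant is then `-n (2ρs + |ds|²)`. So the Einstein equation is the middle slot of the
tractor equation for `I = (s, ds, ρ)`, and its constant is `-n |I|²`: see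
`IsCoordMetric.hess_of_ricci_eq` and `IsCoordMetric.ricci_eq_of_hess`. The top slot holds because `μ
= ds`. The bottom slot follows by differentiating `|I|² = 1` and dividing by `s`
(`IsCoordMetric.pd_rho`).

These computations need `s ≠ 0`, but the resulting equations for `(s, ds, ρ)` have coefficients
continuous up to the boundary, and the interior is dense (`eq_zero_of_eq_zero_on_compl_boundary`);
so they hold on all of `M`. At the boundary the length equation reads `|ds|² = 1`.

The same principle globalises `ρ`. In the interior, `2ρσ + |dσ|² = 1` determines `ρ`, so its local
formulas agree on overlaps (`exists_bottom_slot`) and obey the transformation law of the bottom slot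
(`bottom_slot_transform`). Neither the coordinate invariance of `Δ` and `J` nor their conformal
change has to be computed.

Conversely, a parallel tractor has `μ = dσ`, so `σ⁻² g` is Einstein with constant `-n |I|²`. The
scale may be negative on some components, so a locally constant sign is absorbed into `τ`
(`exists_sign`). It exists because near each point the interior looks like a convex piece of the
half space, on which `σ` has no zero. -/

noncomputable section

namespace ConformalGeometry

set_option linter.unusedSectionVars false

open Topology Filter

/-! ## Calculus with partial derivatives in the half space -/

/-- `U` is a relatively open subset of the closed half space. -/
structure IsRelOpen {n : ℕ} (U : Set (Coord n)) : Prop where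
  subset : U ⊆ Set.range (𝓡∂ (n + 1))
  mem_nhdsWithin : ∀ y ∈ U, U ∈ 𝓝[Set.range (𝓡∂ (n + 1))] y

section Calculus

variable {n : ℕ} {U : Set (Coord n)} {f g : Coord n → ℝ} {y : Coord n}

theorem IsRelOpen.contDiffWithinAt (hU : IsRelOpen U) (hf : ContDiffOn ℝ ∞ f U) (hy : y ∈ U) :
    ContDiffWithinAt ℝ ∞ f (Set.range (𝓡∂ (n + 1))) y :=
  (hf y hy).mono_of_mem_nhdsWithin (hU.mem_nhdsWithin y hy)

theorem IsRelOpen.differentiableWithinAt (hU : IsRelOpen U) (hf : ContDiffOn ℝ ∞ f U)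
    (hy : y ∈ U) : DifferentiableWithinAt ℝ f (Set.range (𝓡∂ (n + 1))) y :=
  (hU.contDiffWithinAt hf hy).differentiableWithinAt (by simp)

theorem IsRelOpen.uniqueDiffWithinAt (hU : IsRelOpen U) (hy : y ∈ U) :
    UniqueDiffWithinAt ℝ (Set.range (𝓡∂ (n + 1))) y :=
  (𝓡∂ (n + 1)).uniqueDiffOn y (hU.subset hy)

theorem pd_congr (hU : IsRelOpen U) (h : ∀ z ∈ U, f z = g z) (i : Fin (n + 1)) (hy : y ∈ U) :
    pd i f y = pd i g y := by
  have : f =ᶠ[𝓝[Set.range (𝓡∂ (n + 1))] y] g := by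
    filter_upwards [hU.mem_nhdsWithin y hy] with z hz using h z hz
  rw [pd, pd, this.fderivWithin_eq (h y hy)]

theorem contDiffOn_pd (hU : IsRelOpen U) (hf : ContDiffOn ℝ ∞ f U) (i : Fin (n + 1)) :
    ContDiffOn ℝ ∞ (pd i f) U := by
  intro y hy
  have h := (hU.contDiffWithinAt hf hy).fderivWithin_right (m := ∞) (𝓡∂ (n + 1)).uniqueDiffOn
    (by simp) (hU.subset hy)
  exact (h.clm_apply contDiffWithinAt_const).mono hU.subset

theorem pd_const (c : ℝ) (i : Fin (n + 1)) :
    pd i (fun _ : Coord n => c) y = 0 := by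
  simp [pd]

theorem pd_add (hU : IsRelOpen U) (hf : ContDiffOn ℝ ∞ f U) (hg : ContDiffOn ℝ ∞ g U)
    (i : Fin (n + 1)) (hy : y ∈ U) : pd i (fun z => f z + g z) y = pd i f y + pd i g y := by
  rw [pd, fderivWithin_fun_add (hU.uniqueDiffWithinAt hy) (hU.differentiableWithinAt hf hy)
    (hU.differentiableWithinAt hg hy)]
  rfl

theorem pd_sub (hU : IsRelOpen U) (hf : ContDiffOn ℝ ∞ f U) (hg : ContDiffOn ℝ ∞ g U)
    (i : Fin (n + 1)) (hy : y ∈ U) : pd i (fun z => f z - g z) y = pd i f y - pd i g y := by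
  rw [pd, fderivWithin_fun_sub (hU.uniqueDiffWithinAt hy) (hU.differentiableWithinAt hf hy)
    (hU.differentiableWithinAt hg hy)]
  rfl

theorem pd_mul (hU : IsRelOpen U) (hf : ContDiffOn ℝ ∞ f U) (hg : ContDiffOn ℝ ∞ g U)
    (i : Fin (n + 1)) (hy : y ∈ U) :
    pd i (fun z => f z * g z) y = f y * pd i g y + g y * pd i f y := by
  rw [pd, fderivWithin_fun_mul (hU.uniqueDiffWithinAt hy) (hU.differentiableWithinAt hf hy)
    (hU.differentiableWithinAt hg hy)]
  rfl

theorem pd_const_mul (hU : IsRelOpen U) (c : ℝ) (hf : ContDiffOn ℝ ∞ f U)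
    (i : Fin (n + 1)) (hy : y ∈ U) : pd i (fun z => c * f z) y = c * pd i f y := by
  rw [pd_mul hU contDiffOn_const hf i hy, pd_const]
  ring

theorem pd_sum {ι : Type*} (s : Finset ι) {f : ι → Coord n → ℝ} (hU : IsRelOpen U)
    (hf : ∀ a, ContDiffOn ℝ ∞ (f a) U) (i : Fin (n + 1)) (hy : y ∈ U) :
    pd i (fun z => ∑ a ∈ s, f a z) y = ∑ a ∈ s, pd i (f a) y := by
  rw [pd, fderivWithin_fun_sum (hU.uniqueDiffWithinAt hy)
    (fun a _ => hU.differentiableWithinAt (hf a) hy)]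
  simp [pd]

theorem pd_inv (hU : IsRelOpen U) (hf : ContDiffOn ℝ ∞ f U) (h0 : ∀ z ∈ U, f z ≠ 0)
    (i : Fin (n + 1)) (hy : y ∈ U) : pd i (fun z => (f z)⁻¹) y = -(pd i f y) / (f y) ^ 2 := by
  -- The product rule for `f * f⁻¹ = 1` is solved for the derivative of `f⁻¹`.
  have hi : ContDiffOn ℝ ∞ (fun z => (f z)⁻¹) U := hf.inv h0
  have h1 : pd i (fun z => f z * (f z)⁻¹) y = 0 := by
    rw [pd_congr (g := fun _ => 1) hU (fun z hz => mul_inv_cancel₀ (h0 z hz)) i hy, pd_const]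
  rw [pd_mul hU hf hi i hy] at h1
  have := h0 y hy
  field_simp at h1 ⊢
  linarith

/-- Symmetry of second derivatives persists at boundary points because the half space lies in the
closure of its interior. -/
theorem pd_comm (hU : IsRelOpen U) (hf : ContDiffOn ℝ ∞ f U) (i j : Fin (n + 1)) (hy : y ∈ U) :
    pd i (pd j f) y = pd j (pd i f) y := by
  have hS := (𝓡∂ (n + 1)).uniqueDiffOn
  have h : IsSymmSndFDerivWithinAt ℝ f (Set.range (𝓡∂ (n + 1))) y := by
    refine (hU.contDiffWithinAt hf hy).isSymmSndFDerivWithinAt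
      (by simpa using (ENat.LEInfty.out : (2 : WithTop ℕ∞) ≤ ∞)) hS ?_ (hU.subset hy)
    exact (𝓡∂ (n + 1)).range_subset_closure_interior (hU.subset hy)
  have hd : DifferentiableWithinAt ℝ (fderivWithin ℝ f (Set.range (𝓡∂ (n + 1))))
      (Set.range (𝓡∂ (n + 1))) y :=
    ((hU.contDiffWithinAt hf hy).fderivWithin_right (m := ∞) hS
      (by simp) (hU.subset hy)).differentiableWithinAt (by simp)
  have key : ∀ k l : Fin (n + 1), pd k (pd l f) y =
      fderivWithin ℝ (fderivWithin ℝ f (Set.range (𝓡∂ (n + 1)))) (Set.range (𝓡∂ (n + 1))) y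
        (EuclideanSpace.single k 1) (EuclideanSpace.single l 1) := by
    intro k l
    rw [pd]
    change fderivWithin ℝ (fun z => fderivWithin ℝ f (Set.range (𝓡∂ (n + 1))) z
      (EuclideanSpace.single l 1)) _ y _ = _
    rw [fderivWithin_clm_apply (hU.uniqueDiffWithinAt hy) hd (differentiableWithinAt_const _)]
    simp
  rw [key, key]
  exact h _ _

theorem IsRelOpen.inter_ne_zero (hU : IsRelOpen U) (hf : ContDiffOn ℝ ∞ f U) :
    IsRelOpen (U ∩ {z | f z ≠ 0}) where
  subset := fun _ h => hU.subset h.1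
  mem_nhdsWithin := by
    rintro z ⟨hz, hfz⟩
    exact inter_mem (hU.mem_nhdsWithin z hz)
      ((hU.contDiffWithinAt hf hz).continuousWithinAt (isOpen_ne.mem_nhds hfz))

theorem contDiffOn_det {m : Type*} [Fintype m] [DecidableEq m] {A : Coord n → Matrix m m ℝ}
    (hA : ∀ i j, ContDiffOn ℝ ∞ (fun z => A z i j) U) : ContDiffOn ℝ ∞ (fun z => (A z).det) U := by
  simp only [Matrix.det_apply]
  refine ContDiffOn.sum fun σ _ => ?_
  refine ContDiffOn.const_smul _ ?_
  exact contDiffOn_prod fun i _ => hA _ _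

/-- By Cramer's rule the entries of the inverse are cofactors divided by the determinant. -/
theorem contDiffOn_matrix_inv {m : Type*} [Fintype m] [DecidableEq m] {A : Coord n → Matrix m m ℝ}
    (hA : ∀ i j, ContDiffOn ℝ ∞ (fun z => A z i j) U) (h0 : ∀ z ∈ U, (A z).det ≠ 0) (i j : m) :
    ContDiffOn ℝ ∞ (fun z => (A z)⁻¹ i j) U := by
  simp only [Matrix.inv_def, Ring.inverse_eq_inv', Matrix.smul_apply, smul_eq_mul,
    Matrix.adjugate_apply]
  refine ((contDiffOn_det hA).inv h0).mul (contDiffOn_det fun k l => ?_)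
  by_cases hk : k = j
  · subst hk; simpa using contDiffOn_const
  · simpa [Matrix.updateRow_ne hk] using hA k l

end Calculus

/-! ## Riemannian geometry in coordinates -/

/-- `G` is the component matrix of a smooth nondegenerate symmetric bilinear form on `U`. -/
structure IsCoordMetric {n : ℕ} (U : Set (Coord n))
    (G : Coord n → Matrix (Fin (n + 1)) (Fin (n + 1)) ℝ) : Prop where
  isRelOpen : IsRelOpen U
  smooth : ∀ i j, ContDiffOn ℝ ∞ (fun z => G z i j) U
  symm : ∀ z ∈ U, ∀ i j, G z i j = G z j i
  det_ne_zero : ∀ z ∈ U, (G z).det ≠ 0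

/-- The Hessian `∇_a ∇_b s`. -/
def hess {n : ℕ} (G : Coord n → Matrix (Fin (n + 1)) (Fin (n + 1)) ℝ) (s : Coord n → ℝ)
    (a b : Fin (n + 1)) (y : Coord n) : ℝ :=
  pd a (pd b s) y - ∑ e, christoffel G e a b y * pd e s y

/-- The Laplacian `∇^a ∇_a s`. -/
def lap {n : ℕ} (G : Coord n → Matrix (Fin (n + 1)) (Fin (n + 1)) ℝ) (s : Coord n → ℝ)
    (y : Coord n) : ℝ :=
  ∑ a, ∑ b, (G y)⁻¹ a b * hess G s a b y

/-- The squared length `|ds|²`. -/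
def gradSq {n : ℕ} (G : Coord n → Matrix (Fin (n + 1)) (Fin (n + 1)) ℝ) (s : Coord n → ℝ)
    (y : Coord n) : ℝ :=
  ∑ a, ∑ b, (G y)⁻¹ a b * pd a s y * pd b s y

section

variable {n : ℕ} {U : Set (Coord n)} {G : Coord n → Matrix (Fin (n + 1)) (Fin (n + 1)) ℝ}
  {s : Coord n → ℝ} {y : Coord n}

namespace IsCoordMetric

theorem smooth_inv (hG : IsCoordMetric U G) (i j : Fin (n + 1)) :
    ContDiffOn ℝ ∞ (fun z => (G z)⁻¹ i j) U :=
  contDiffOn_matrix_inv hG.smooth hG.det_ne_zero i j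

theorem inv_symm (hG : IsCoordMetric U G) (hy : y ∈ U) (i j : Fin (n + 1)) :
    (G y)⁻¹ i j = (G y)⁻¹ j i := by
  have h : (G y).transpose = G y := by ext i j; exact hG.symm y hy j i
  conv_lhs => rw [← h, ← Matrix.transpose_nonsing_inv]
  rfl

theorem inv_mul (hG : IsCoordMetric U G) (hy : y ∈ U) (i j : Fin (n + 1)) :
    ∑ k, (G y)⁻¹ i k * G y k j = if i = j then 1 else 0 := by
  have h := Matrix.nonsing_inv_mul (G y) (isUnit_iff_ne_zero.2 (hG.det_ne_zero y hy))
  rw [← Matrix.mul_apply, h, Matrix.one_apply]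

theorem mul_inv (hG : IsCoordMetric U G) (hy : y ∈ U) (i j : Fin (n + 1)) :
    ∑ k, G y i k * (G y)⁻¹ k j = if i = j then 1 else 0 := by
  have h := Matrix.mul_nonsing_inv (G y) (isUnit_iff_ne_zero.2 (hG.det_ne_zero y hy))
  rw [← Matrix.mul_apply, h, Matrix.one_apply]

theorem smooth_christoffel (hG : IsCoordMetric U G) (k i j : Fin (n + 1)) :
    ContDiffOn ℝ ∞ (christoffel G k i j) U := by
  unfold christoffel
  refine contDiffOn_const.mul (ContDiffOn.sum fun l _ => (hG.smooth_inv k l).mul ?_)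
  exact ((contDiffOn_pd hG.isRelOpen (hG.smooth j l) i).add
    (contDiffOn_pd hG.isRelOpen (hG.smooth i l) j)).sub
    (contDiffOn_pd hG.isRelOpen (hG.smooth i j) l)

theorem smooth_riemann (hG : IsCoordMetric U G) (a b c e : Fin (n + 1)) :
    ContDiffOn ℝ ∞ (riemann G a b c e) U := by
  unfold riemann
  refine ((contDiffOn_pd hG.isRelOpen (hG.smooth_christoffel c b e) a).sub
    (contDiffOn_pd hG.isRelOpen (hG.smooth_christoffel c a e) b)).add
    (ContDiffOn.sum fun f _ => ?_)
  exact ((hG.smooth_christoffel c a f).mul (hG.smooth_christoffel f b e)).sub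
    ((hG.smooth_christoffel c b f).mul (hG.smooth_christoffel f a e))

theorem smooth_ricci (hG : IsCoordMetric U G) (a b : Fin (n + 1)) :
    ContDiffOn ℝ ∞ (fun z => ricci G z a b) U := by
  simp only [ricci, Matrix.of_apply]
  exact ContDiffOn.sum fun c _ => hG.smooth_riemann c a c b

theorem smooth_scal (hG : IsCoordMetric U G) : ContDiffOn ℝ ∞ (scal G) U :=
  ContDiffOn.sum fun a _ => ContDiffOn.sum fun b _ => (hG.smooth_inv a b).mul (hG.smooth_ricci a b)

theorem smooth_schouten (hG : IsCoordMetric U G) (a b : Fin (n + 1)) :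
    ContDiffOn ℝ ∞ (fun z => schouten G z a b) U := by
  simp only [schouten, Matrix.smul_apply, Matrix.sub_apply, smul_eq_mul]
  exact contDiffOn_const.mul ((hG.smooth_ricci a b).sub
    ((hG.smooth_scal.div_const _).mul (hG.smooth a b)))

theorem smooth_hess (hG : IsCoordMetric U G) (hs : ContDiffOn ℝ ∞ s U) (a b : Fin (n + 1)) :
    ContDiffOn ℝ ∞ (hess G s a b) U :=
  (contDiffOn_pd hG.isRelOpen (contDiffOn_pd hG.isRelOpen hs b) a).sub
    (ContDiffOn.sum fun e _ => (hG.smooth_christoffel e a b).mul (contDiffOn_pd hG.isRelOpen hs e))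

theorem smooth_lap (hG : IsCoordMetric U G) (hs : ContDiffOn ℝ ∞ s U) :
    ContDiffOn ℝ ∞ (lap G s) U :=
  ContDiffOn.sum fun a _ => ContDiffOn.sum fun b _ => (hG.smooth_inv a b).mul (hG.smooth_hess hs a b)

theorem smooth_gradSq (hG : IsCoordMetric U G) (hs : ContDiffOn ℝ ∞ s U) :
    ContDiffOn ℝ ∞ (gradSq G s) U :=
  ContDiffOn.sum fun a _ => ContDiffOn.sum fun b _ =>
    ((hG.smooth_inv a b).mul (contDiffOn_pd hG.isRelOpen hs a)).mul
      (contDiffOn_pd hG.isRelOpen hs b)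

theorem christoffel_symm (hG : IsCoordMetric U G) (hy : y ∈ U) (k i j : Fin (n + 1)) :
    christoffel G k i j y = christoffel G k j i y := by
  unfold christoffel
  congr 1
  refine Finset.sum_congr rfl fun l _ => ?_
  rw [pd_congr (g := fun z => G z j i) hG.isRelOpen (fun z hz => hG.symm z hz i j) l hy]
  ring

/-- Lowering the index cancels the inverse metric in the definition and leaves the Christoffel
symbols of the first kind. -/
theorem sum_christoffel_mul (hG : IsCoordMetric U G) (hy : y ∈ U) (i j b : Fin (n + 1)) :
    ∑ k, christoffel G k i j y * G y k b = (1 / 2) *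
      (pd i (fun z => G z j b) y + pd j (fun z => G z i b) y - pd b (fun z => G z i j) y) := by
  unfold christoffel
  generalize hT : (fun l => pd i (fun z => G z j l) y + pd j (fun z => G z i l) y
    - pd l (fun z => G z i j) y) = T
  have hT' : ∀ l, pd i (fun z => G z j l) y + pd j (fun z => G z i l) y
    - pd l (fun z => G z i j) y = T l := fun l => congrFun hT l
  simp only [hT', mul_assoc, ← Finset.mul_sum]
  congr 1
  calc ∑ k, (∑ l, (G y)⁻¹ k l * T l) * G y k b
      = ∑ l, T l * ∑ k, (G y)⁻¹ l k * G y k b := by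
        simp only [Finset.sum_mul, Finset.mul_sum]
        rw [Finset.sum_comm]
        refine Finset.sum_congr rfl fun l _ => Finset.sum_congr rfl fun k _ => ?_
        rw [hG.inv_symm hy k l]
        ring
    _ = T b := by simp [hG.inv_mul hy]

/-- The Levi-Civita connection is compatible with the metric. -/
theorem pd_metric (hG : IsCoordMetric U G) (hy : y ∈ U) (c a b : Fin (n + 1)) :
    pd c (fun z => G z a b) y =
      ∑ e, christoffel G e c a y * G y e b + ∑ e, christoffel G e c b y * G y e a := by
  rw [hG.sum_christoffel_mul hy, hG.sum_christoffel_mul hy,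
    pd_congr (g := fun z => G z a b) hG.isRelOpen (fun z hz => hG.symm z hz b a) c hy]
  ring

/-- Metric compatibility for `G⁻¹`: differentiate `G⁻¹ G = 1`, contract with a second `G⁻¹`, and
insert `pd_metric`. -/
theorem pd_inv_metric (hG : IsCoordMetric U G) (hy : y ∈ U) (c e f : Fin (n + 1)) :
    pd c (fun z => (G z)⁻¹ e f) y =
      -∑ a, christoffel G e c a y * (G y)⁻¹ a f - ∑ a, christoffel G f c a y * (G y)⁻¹ a e := by
  have hU := hG.isRelOpen
  have h1 : ∀ b, ∑ k, ((G y)⁻¹ e k * pd c (fun z => G z k b) y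
      + G y k b * pd c (fun z => (G z)⁻¹ e k) y) = 0 := by
    intro b
    have h : pd c (fun z => ∑ k, (G z)⁻¹ e k * G z k b) y = 0 := by
      rw [pd_congr (g := fun _ => if e = b then 1 else 0) hU (fun z hz => hG.inv_mul hz e b) c hy,
        pd_const]
    rw [pd_sum _ hU (fun k => (hG.smooth_inv e k).mul (hG.smooth k b)) c hy] at h
    rw [← h]
    exact Finset.sum_congr rfl fun k _ =>
      (pd_mul hU (hG.smooth_inv e k) (hG.smooth k b) c hy).symm
  have h2 : ∑ b, (∑ k, G y k b * pd c (fun z => (G z)⁻¹ e k) y) * (G y)⁻¹ b f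
      = pd c (fun z => (G z)⁻¹ e f) y := by
    simp only [Finset.sum_mul]
    rw [Finset.sum_comm]
    calc ∑ k, ∑ b, G y k b * pd c (fun z => (G z)⁻¹ e k) y * (G y)⁻¹ b f
        = ∑ k, pd c (fun z => (G z)⁻¹ e k) y * ∑ b, G y k b * (G y)⁻¹ b f := by
          simp only [Finset.mul_sum]
          exact Finset.sum_congr rfl fun k _ => Finset.sum_congr rfl fun b _ => by ring
      _ = _ := by simp [hG.mul_inv hy]
  have h3 : ∀ b, ∑ k, G y k b * pd c (fun z => (G z)⁻¹ e k) y
      = -∑ k, (G y)⁻¹ e k * (∑ l, christoffel G l c k y * G y l b)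
        - ∑ k, (G y)⁻¹ e k * (∑ l, christoffel G l c b y * G y l k) := by
    intro b
    have := h1 b
    simp only [hG.pd_metric hy, mul_add, Finset.sum_add_distrib] at this
    linarith
  have h4 : ∀ b, ∑ k, (G y)⁻¹ e k * (∑ l, christoffel G l c b y * G y l k)
      = christoffel G e c b y := by
    intro b
    simp only [Finset.mul_sum]
    rw [Finset.sum_comm]
    calc ∑ l, ∑ k, (G y)⁻¹ e k * (christoffel G l c b y * G y l k)
        = ∑ l, christoffel G l c b y * ∑ k, (G y)⁻¹ e k * G y k l := by
          simp only [Finset.mul_sum]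
          refine Finset.sum_congr rfl fun l _ => Finset.sum_congr rfl fun k _ => ?_
          rw [hG.symm y hy l k]; ring
      _ = _ := by simp [hG.inv_mul hy]
  have h5 : ∑ b, (∑ k, (G y)⁻¹ e k * (∑ l, christoffel G l c k y * G y l b)) * (G y)⁻¹ b f
      = ∑ k, christoffel G f c k y * (G y)⁻¹ k e := by
    calc ∑ b, (∑ k, (G y)⁻¹ e k * (∑ l, christoffel G l c k y * G y l b)) * (G y)⁻¹ b f
        = ∑ k, (G y)⁻¹ e k * ∑ l, christoffel G l c k y * ∑ b, G y l b * (G y)⁻¹ b f := by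
          simp only [Finset.sum_mul, Finset.mul_sum]
          rw [Finset.sum_comm]
          refine Finset.sum_congr rfl fun k _ => ?_
          rw [Finset.sum_comm]
          exact Finset.sum_congr rfl fun k _ => Finset.sum_congr rfl fun b _ => by ring
      _ = _ := by
          simp only [hG.mul_inv hy]
          simp only [mul_ite, mul_one, mul_zero, Finset.sum_ite_eq', Finset.mem_univ, if_true]
          refine Finset.sum_congr rfl fun k _ => ?_
          rw [hG.inv_symm hy e k]; ring
  rw [← h2]
  simp only [h3, h4, sub_mul, neg_mul, Finset.sum_sub_distrib, Finset.sum_neg_distrib, h5]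
  ring

end IsCoordMetric

end

/-! ## Conformal change of the Ricci tensor -/

/-- The difference tensor `δ^k_i v_j + δ^k_j v_i - G_{ij} w^k` of the Levi-Civita connections of
two conformal metrics. -/
def conformalDiff {ι : Type*} [DecidableEq ι] (G : ι → ι → ℝ) (v w : ι → ℝ) (k i j : ι) : ℝ :=
  (if k = i then v j else 0) + (if k = j then v i else 0) - G i j * w k

/-! ### Pointwise algebra of the difference tensor -/

section Contraction

variable {ι : Type*} [Fintype ι] [DecidableEq ι] {Γ : ι → ι → ι → ℝ} {G : ι → ι → ℝ}
  {v w : ι → ℝ}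

/-- The first delta contributes the dimension times `v b`; the other two terms contribute `v b` and
`-v b` and cancel. -/
theorem sum_conformalDiff_trace (hG : ∀ i j, G i j = G j i) (hw : ∀ a, ∑ k, G a k * w k = v a)
    (b : ι) : ∑ c, conformalDiff G v w c c b = Fintype.card ι * v b := by
  simp only [conformalDiff, Finset.sum_add_distrib, Finset.sum_sub_distrib]
  simp only [fun c => hG c b, hw]
  simp

theorem sum_christoffel_mul_conformalDiff (a b : ι) :
    ∑ c, ∑ f, Γ c c f * conformalDiff G v w f a b =
      (∑ c, Γ c c a) * v b + (∑ c, Γ c c b) * v a - G a b * ∑ c, ∑ f, Γ c c f * w f := by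
  simp only [conformalDiff, mul_add, mul_sub, mul_ite, mul_zero, Finset.sum_add_distrib,
    Finset.sum_sub_distrib, Finset.sum_ite_eq', Finset.mem_univ, if_true, Finset.sum_mul,
    Finset.mul_sum]
  congr 1
  exact Finset.sum_congr rfl fun c _ => Finset.sum_congr rfl fun f _ => by ring

theorem sum_christoffel_mul_conformalDiff' (a b : ι) :
    ∑ c, ∑ f, Γ c a f * conformalDiff G v w f c b =
      (∑ c, Γ c a c) * v b + (∑ c, Γ c a b * v c) - ∑ c, ∑ f, Γ c a f * G c b * w f := by
  simp only [conformalDiff, mul_add, mul_sub, mul_ite, mul_zero, Finset.sum_add_distrib,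
    Finset.sum_sub_distrib, Finset.sum_ite_eq', Finset.mem_univ, if_true, Finset.sum_mul]
  congr 1
  exact Finset.sum_congr rfl fun c _ => Finset.sum_congr rfl fun f _ => by ring

theorem sum_conformalDiff_mul_christoffel (hG : ∀ i j, G i j = G j i) (a b : ι) :
    ∑ c, ∑ f, conformalDiff G v w c a f * Γ f c b =
      (∑ f, v f * Γ f a b) + v a * (∑ c, Γ c c b) - ∑ c, ∑ f, Γ f c b * G f a * w c := by
  simp only [conformalDiff, add_mul, sub_mul, ite_mul, zero_mul, Finset.sum_add_distrib,
    Finset.sum_sub_distrib]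
  rw [Finset.sum_comm]
  simp only [Finset.sum_ite_eq', Finset.sum_ite_eq, Finset.mem_univ, if_true, Finset.mul_sum]
  have : ∑ c, ∑ f, G a f * w c * Γ f c b = ∑ c, ∑ f, Γ f c b * G f a * w c :=
    Finset.sum_congr rfl fun c _ => Finset.sum_congr rfl fun f _ => by rw [hG a f]; ring
  rw [this]

theorem sum_trace_mul_conformalDiff (a b : ι) :
    ∑ f, v f * conformalDiff G v w f a b = 2 * v a * v b - G a b * ∑ f, v f * w f := by
  simp only [conformalDiff, mul_add, mul_sub, mul_ite, mul_zero, Finset.sum_add_distrib,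
    Finset.sum_sub_distrib, Finset.sum_ite_eq', Finset.mem_univ, if_true, Finset.mul_sum]
  have : ∑ c, v c * (G a b * w c) = ∑ c, G a b * (v c * w c) :=
    Finset.sum_congr rfl fun c _ => by ring
  rw [this]
  ring

theorem sum_conformalDiff_mul_conformalDiff (hG : ∀ i j, G i j = G j i)
    (hw : ∀ a, ∑ k, G a k * w k = v a) (a b : ι) :
    ∑ c, ∑ f, conformalDiff G v w c a f * conformalDiff G v w f c b =
      (Fintype.card ι + 2) * v a * v b - 2 * G a b * ∑ f, v f * w f := by
  -- Only the first factor is expanded. Its three terms contract the second factor with `v`, with a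
  -- delta, and with `G a f`.
  have e : ∀ c, ∑ f, conformalDiff G v w c a f * conformalDiff G v w f c b =
      (if c = a then (2 * v c * v b - G c b * ∑ f, v f * w f) else 0)
      + v a * conformalDiff G v w c c b
      - w c * (G a c * v b + G a b * v c - G c b * v a) := by
    intro c
    have h1 : ∑ f, (if c = a then v f else 0) * conformalDiff G v w f c b =
        if c = a then (2 * v c * v b - G c b * ∑ f, v f * w f) else 0 := by
      split_ifs
      · exact sum_trace_mul_conformalDiff c b
      · simp
    have h2 : ∑ f, (if c = f then v a else 0) * conformalDiff G v w f c b
        = v a * conformalDiff G v w c c b := by simp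
    have h3 : ∑ f, G a f * conformalDiff G v w f c b
        = G a c * v b + G a b * v c - G c b * v a := by
      simp only [conformalDiff, mul_add, mul_sub, mul_ite, mul_zero, Finset.sum_add_distrib,
        Finset.sum_sub_distrib, Finset.sum_ite_eq', Finset.mem_univ, if_true]
      congr 1
      rw [← hw a, Finset.mul_sum]
      exact Finset.sum_congr rfl fun f _ => by ring
    have h4 : ∑ f, G a f * w c * conformalDiff G v w f c b
        = w c * ∑ f, G a f * conformalDiff G v w f c b := by
      rw [Finset.mul_sum]
      exact Finset.sum_congr rfl fun f _ => by ring
    conv_lhs =>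
      enter [2, f]
      rw [conformalDiff, sub_mul, add_mul]
    rw [Finset.sum_sub_distrib, Finset.sum_add_distrib, h1, h2, h4, h3]
  simp only [e, Finset.sum_sub_distrib, Finset.sum_add_distrib, ← Finset.mul_sum,
    sum_conformalDiff_trace hG hw]
  have h5 : ∑ c, w c * (G a c * v b + G a b * v c - G c b * v a)
      = v a * v b + G a b * ∑ f, v f * w f - v b * v a := by
    conv_rhs => rw [← hw a, ← hw b]
    rw [Finset.sum_mul, Finset.mul_sum, Finset.sum_mul, ← Finset.sum_add_distrib,
      ← Finset.sum_sub_distrib]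
    refine Finset.sum_congr rfl fun c _ => ?_
    rw [hw, hw, hG c b]; ring
  rw [h5]
  simp only [Finset.sum_ite_eq', Finset.mem_univ, if_true]
  ring

/-- The conformal change of Ricci as algebra at one point: the derivatives `dv`, `dw`, `dG`, `dΓ`
are formal symbols, tied only by closedness of `v` and metric compatibility. The term subtracted on
the left is the change of `∂_a Γ^c_{cb}`, which is the derivative of a trace and is computed
separately. -/
theorem ricci_contraction_conformal (hΓ : ∀ k i j, Γ k i j = Γ k j i) (hG : ∀ i j, G i j = G j i)
    (hw : ∀ a, ∑ k, G a k * w k = v a) {dv dw : ι → ι → ℝ} {dG : ι → ι → ι → ℝ}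
    {dΓ : ι → ι → ι → ι → ℝ} (hdv : ∀ a b, dv a b = dv b a)
    (hdG : ∀ c a b, dG c a b = ∑ e, Γ e c a * G e b + ∑ e, Γ e c b * G e a) (a b : ι) :
    ∑ c, ((dΓ c c a b + ((if c = a then dv c b else 0) + (if c = b then dv c a else 0)
            - (dG c a b * w c + G a b * dw c c)))
        - (dΓ a c c b)
        + ∑ f, ((Γ c c f + conformalDiff G v w c c f) * (Γ f a b + conformalDiff G v w f a b)
          - (Γ c a f + conformalDiff G v w c a f) * (Γ f c b + conformalDiff G v w f c b)))
        - Fintype.card ι * dv a b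
      = ∑ c, (dΓ c c a b - dΓ a c c b + ∑ f, (Γ c c f * Γ f a b - Γ c a f * Γ f c b))
        - (Fintype.card ι - 2) * (dv a b - ∑ f, Γ f a b * v f)
        - G a b * ∑ c, (dw c c + ∑ f, Γ c c f * w f)
        + (Fintype.card ι - 2) * (v a * v b - G a b * ∑ f, v f * w f) := by
  have e1 : ∑ c, ∑ f, (Γ c c f + conformalDiff G v w c c f) *
      (Γ f a b + conformalDiff G v w f a b) =
      ∑ c, ∑ f, Γ c c f * Γ f a b + ∑ c, ∑ f, Γ c c f * conformalDiff G v w f a b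
      + Fintype.card ι * ∑ f, v f * Γ f a b
      + Fintype.card ι * ∑ f, v f * conformalDiff G v w f a b := by
    have h : ∀ F : ι → ℝ, ∑ c, ∑ f, conformalDiff G v w c c f * F f
        = Fintype.card ι * ∑ f, v f * F f := by
      intro F
      rw [Finset.sum_comm]
      simp only [← Finset.sum_mul, sum_conformalDiff_trace hG hw, mul_assoc, Finset.mul_sum]
    rw [← h, ← h]
    simp only [← Finset.sum_add_distrib]
    exact Finset.sum_congr rfl fun c _ => Finset.sum_congr rfl fun f _ => by ring
  have e2 : ∑ c, ∑ f, (Γ c a f + conformalDiff G v w c a f) *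
      (Γ f c b + conformalDiff G v w f c b) =
      ∑ c, ∑ f, Γ c a f * Γ f c b + ∑ c, ∑ f, Γ c a f * conformalDiff G v w f c b
      + ∑ c, ∑ f, conformalDiff G v w c a f * Γ f c b
      + ∑ c, ∑ f, conformalDiff G v w c a f * conformalDiff G v w f c b := by
    simp only [← Finset.sum_add_distrib]
    exact Finset.sum_congr rfl fun c _ => Finset.sum_congr rfl fun f _ => by ring
  rw [sum_conformalDiff_mul_conformalDiff hG hw] at e2
  -- Compatibility turns `∂_c G_{ab} w^c` into exactly the two sums that the mixed products in `e2`
  -- leave over, so they cancel.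
  have e3 : ∑ c, dG c a b * w c = ∑ c, ∑ f, Γ c a f * G c b * w f
      + ∑ c, ∑ f, Γ f c b * G f a * w c := by
    simp only [hdG, add_mul, Finset.sum_mul, Finset.sum_add_distrib]
    congr 1
    rw [Finset.sum_comm]
    exact Finset.sum_congr rfl fun c _ => Finset.sum_congr rfl fun f _ => by rw [hΓ c f a]
  have e5 : ∑ f, v f * Γ f a b = ∑ f, Γ f a b * v f :=
    Finset.sum_congr rfl fun f _ => mul_comm _ _
  have e6 : ∑ c, Γ c a c = ∑ c, Γ c c a := Finset.sum_congr rfl fun c _ => hΓ _ _ _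
  simp only [Finset.sum_add_distrib, Finset.sum_sub_distrib, ← Finset.mul_sum, e1, e2, e3,
    sum_christoffel_mul_conformalDiff, sum_christoffel_mul_conformalDiff',
    sum_conformalDiff_mul_christoffel hG, sum_trace_mul_conformalDiff, e5, e6]
  simp only [Finset.sum_ite_eq', Finset.mem_univ, if_true, hdv b a]
  ring

end Contraction

/-! ### The Ricci tensor of `s⁻² G` -/

/-- The logarithmic derivative `Υ_j = -∂_j s / s`, the differential of `-log |s|`. -/
def upsilon {n : ℕ} (s : Coord n → ℝ) (j : Fin (n + 1)) (z : Coord n) : ℝ :=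
  -((s z)⁻¹ * pd j s z)

/-- The vector field `Υ^k`. -/
def upsilonUp {n : ℕ} (G : Coord n → Matrix (Fin (n + 1)) (Fin (n + 1)) ℝ) (s : Coord n → ℝ)
    (k : Fin (n + 1)) (z : Coord n) : ℝ :=
  ∑ e, (G z)⁻¹ k e * upsilon s e z

section

variable {n : ℕ} {U : Set (Coord n)} {G : Coord n → Matrix (Fin (n + 1)) (Fin (n + 1)) ℝ}
  {s : Coord n → ℝ} {y : Coord n}

namespace IsCoordMetric

theorem restrict (hG : IsCoordMetric U G) (hs : ContDiffOn ℝ ∞ s U) :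
    IsCoordMetric (U ∩ {z | s z ≠ 0}) G where
  isRelOpen := hG.isRelOpen.inter_ne_zero hs
  smooth := fun i j => (hG.smooth i j).mono Set.inter_subset_left
  symm := fun z hz => hG.symm z hz.1
  det_ne_zero := fun z hz => hG.det_ne_zero z hz.1

theorem smooth_upsilon (hG : IsCoordMetric U G) (hs : ContDiffOn ℝ ∞ s U)
    (hs0 : ∀ z ∈ U, s z ≠ 0) (j : Fin (n + 1)) : ContDiffOn ℝ ∞ (upsilon s j) U :=
  ((hs.inv hs0).mul (contDiffOn_pd hG.isRelOpen hs j)).neg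

theorem smooth_upsilonUp (hG : IsCoordMetric U G) (hs : ContDiffOn ℝ ∞ s U)
    (hs0 : ∀ z ∈ U, s z ≠ 0) (k : Fin (n + 1)) : ContDiffOn ℝ ∞ (upsilonUp G s k) U :=
  ContDiffOn.sum fun e _ => (hG.smooth_inv k e).mul (hG.smooth_upsilon hs hs0 e)

theorem lower_upsilonUp (hG : IsCoordMetric U G) (hy : y ∈ U) (a : Fin (n + 1)) :
    ∑ k, G y a k * upsilonUp G s k y = upsilon s a y := by
  simp only [upsilonUp, Finset.mul_sum]
  rw [Finset.sum_comm]
  calc ∑ e, ∑ k, G y a k * ((G y)⁻¹ k e * upsilon s e y)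
      = ∑ e, (∑ k, G y a k * (G y)⁻¹ k e) * upsilon s e y := by
        simp only [Finset.sum_mul]
        exact Finset.sum_congr rfl fun k _ => Finset.sum_congr rfl fun b _ => by ring
    _ = _ := by simp [hG.mul_inv hy]

/-- The logarithmic derivative of `s⁻²` is `2Υ`. No logarithm is taken, so negative `s` is covered.
-/
theorem pd_conformal (hG : IsCoordMetric U G) (hs : ContDiffOn ℝ ∞ s U)
    (hs0 : ∀ z ∈ U, s z ≠ 0) (hy : y ∈ U) (c i j : Fin (n + 1)) :
    pd c (fun z => (((s z) ^ 2)⁻¹ • G z) i j) y =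
      ((s y) ^ 2)⁻¹ * (pd c (fun z => G z i j) y + 2 * upsilon s c y * G y i j) := by
  have hU := hG.isRelOpen
  have h0 := hs0 y hy
  simp only [Matrix.smul_apply, smul_eq_mul]
  have hs2 : ContDiffOn ℝ ∞ (fun z => (s z) ^ 2) U := hs.pow 2
  have hs20 : ∀ z ∈ U, (s z) ^ 2 ≠ 0 := fun z hz => pow_ne_zero _ (hs0 z hz)
  have hinv : ContDiffOn ℝ ∞ (fun z => ((s z) ^ 2)⁻¹) U := hs2.inv hs20
  rw [pd_mul hU hinv (hG.smooth i j) c hy, pd_inv hU hs2 hs20 c hy]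
  have h2 : pd c (fun z => (s z) ^ 2) y = 2 * s y * pd c s y := by
    simp only [pow_two]
    rw [pd_mul hU hs hs c hy]; ring
  rw [h2, upsilon]
  field_simp

/-- The factor `s²` of the inverse metric cancels `s⁻²`, and the `2Υ` terms of the three metric
derivatives become the three terms of the difference tensor. -/
theorem christoffel_conformal (hG : IsCoordMetric U G) (hs : ContDiffOn ℝ ∞ s U)
    (hs0 : ∀ z ∈ U, s z ≠ 0) (hy : y ∈ U) (k i j : Fin (n + 1)) :
    christoffel (fun z => ((s z) ^ 2)⁻¹ • G z) k i j y = christoffel G k i j y +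
      conformalDiff (G y) (fun a => upsilon s a y) (fun a => upsilonUp G s a y) k i j := by
  have h0 := hs0 y hy
  have hinv : (((s y) ^ 2)⁻¹ • G y)⁻¹ = (s y) ^ 2 • (G y)⁻¹ := by
    have : Invertible ((s y) ^ 2)⁻¹ := invertibleOfNonzero (inv_ne_zero (pow_ne_zero _ h0))
    rw [Matrix.inv_smul _ _ (isUnit_iff_ne_zero.2 (hG.det_ne_zero y hy)), invOf_eq_inv, inv_inv]
  simp only [christoffel, hinv, hG.pd_conformal hs hs0 hy]
  simp only [conformalDiff, Matrix.smul_apply, smul_eq_mul]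
  have e1 : ∀ l, (s y) ^ 2 * (G y)⁻¹ k l *
      (((s y) ^ 2)⁻¹ * (pd i (fun z => G z j l) y + 2 * upsilon s i y * G y j l) +
        ((s y) ^ 2)⁻¹ * (pd j (fun z => G z i l) y + 2 * upsilon s j y * G y i l) -
        ((s y) ^ 2)⁻¹ * (pd l (fun z => G z i j) y + 2 * upsilon s l y * G y i j)) =
      (G y)⁻¹ k l * (pd i (fun z => G z j l) y + pd j (fun z => G z i l) y
        - pd l (fun z => G z i j) y)
      + 2 * upsilon s i y * ((G y)⁻¹ k l * G y l j) + 2 * upsilon s j y * ((G y)⁻¹ k l * G y l i)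
      - 2 * G y i j * ((G y)⁻¹ k l * upsilon s l y) := by
    intro l
    rw [hG.symm y hy j l, hG.symm y hy i l]
    field_simp
    ring
  simp only [e1, Finset.sum_add_distrib, Finset.sum_sub_distrib, ← Finset.mul_sum, hG.inv_mul hy]
  rw [← upsilonUp]
  split_ifs <;> ring

theorem pd_upsilon (hG : IsCoordMetric U G) (hs : ContDiffOn ℝ ∞ s U)
    (hs0 : ∀ z ∈ U, s z ≠ 0) (hy : y ∈ U) (a b : Fin (n + 1)) :
    pd a (upsilon s b) y = -((s y)⁻¹ * pd a (pd b s) y) + upsilon s a y * upsilon s b y := by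
  have hU := hG.isRelOpen
  have h0 := hs0 y hy
  have hinv : ContDiffOn ℝ ∞ (fun z => (s z)⁻¹) U := hs.inv hs0
  have e : pd a (upsilon s b) y = pd a (fun z => (-1) * ((s z)⁻¹ * pd b s z)) y :=
    pd_congr hU (fun z _ => by rw [upsilon]; ring) a hy
  rw [e, pd_const_mul hU _ (hinv.mul (contDiffOn_pd hU hs b)) a hy,
    pd_mul hU hinv (contDiffOn_pd hU hs b) a hy, pd_inv hU hs hs0 a hy, upsilon, upsilon]
  field_simp
  ring

/-- The divergence of `Υ^k`. -/
theorem div_upsilonUp (hG : IsCoordMetric U G) (hs : ContDiffOn ℝ ∞ s U)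
    (hs0 : ∀ z ∈ U, s z ≠ 0) (hy : y ∈ U) :
    ∑ c, (pd c (upsilonUp G s c) y + ∑ f, christoffel G c c f y * upsilonUp G s f y) =
      ∑ a, ∑ b, (G y)⁻¹ a b * (pd a (upsilon s b) y - ∑ e, christoffel G e a b y * upsilon s e y) := by
  have hU := hG.isRelOpen
  have e1 : ∀ c, pd c (upsilonUp G s c) y = ∑ e, (G y)⁻¹ c e * pd c (upsilon s e) y
      + ∑ e, upsilon s e y * pd c (fun z => (G z)⁻¹ c e) y := by
    intro c
    rw [← Finset.sum_add_distrib]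
    have := pd_sum Finset.univ hU
      (fun e => (hG.smooth_inv c e).mul (hG.smooth_upsilon hs hs0 e)) c hy
    refine this.trans (Finset.sum_congr rfl fun e _ => ?_)
    exact pd_mul hU (hG.smooth_inv c e) (hG.smooth_upsilon hs hs0 e) c hy
  -- Of the two terms from `pd_inv_metric`, one cancels the connection term of the divergence and
  -- the other completes `∂Υ` to `∇Υ`.
  have e2 : ∑ c, ∑ e, upsilon s e y * pd c (fun z => (G z)⁻¹ c e) y =
      -∑ c, ∑ f, christoffel G c c f y * upsilonUp G s f y
      - ∑ a, ∑ b, (G y)⁻¹ a b * ∑ e, christoffel G e a b y * upsilon s e y := by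
    simp only [hG.pd_inv_metric hy, mul_sub, mul_neg, Finset.sum_sub_distrib,
      Finset.sum_neg_distrib, upsilonUp]
    congr 1
    · congr 1
      refine Finset.sum_congr rfl fun c _ => ?_
      simp only [Finset.mul_sum]
      rw [Finset.sum_comm]
      exact Finset.sum_congr rfl fun k _ => Finset.sum_congr rfl fun b _ => by ring
    · refine Finset.sum_congr rfl fun c _ => ?_
      simp only [Finset.mul_sum]
      rw [Finset.sum_comm]
      refine Finset.sum_congr rfl fun k _ => Finset.sum_congr rfl fun b _ => ?_
      rw [hG.inv_symm hy k c]
      ring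
  simp only [e1, Finset.sum_add_distrib, e2, mul_sub, Finset.sum_sub_distrib]
  ring

/-- The term `Υ_a Υ_b` cancels the quadratic term in the conformal change of Ricci. Expressed
through `s`, the part of the change that is not a multiple of `G` is therefore the Hessian alone. -/
theorem hess_upsilon (hG : IsCoordMetric U G) (hs : ContDiffOn ℝ ∞ s U)
    (hs0 : ∀ z ∈ U, s z ≠ 0) (hy : y ∈ U) (a b : Fin (n + 1)) :
    pd a (upsilon s b) y - ∑ e, christoffel G e a b y * upsilon s e y =
      -((s y)⁻¹ * hess G s a b y) + upsilon s a y * upsilon s b y := by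
  have : ∑ e, christoffel G e a b y * upsilon s e y
      = -((s y)⁻¹ * ∑ e, christoffel G e a b y * pd e s y) := by
    simp only [upsilon, Finset.mul_sum]
    rw [← Finset.sum_neg_distrib]
    exact Finset.sum_congr rfl fun e _ => by ring
  rw [hG.pd_upsilon hs hs0 hy, this, hess]
  ring

theorem sum_upsilon_mul_upsilonUp :
    ∑ f, upsilon s f y * upsilonUp G s f y = ((s y)⁻¹) ^ 2 * gradSq G s y := by
  simp only [upsilonUp, upsilon, gradSq, Finset.mul_sum]
  exact Finset.sum_congr rfl fun k _ => Finset.sum_congr rfl fun b _ => by ring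

theorem pd_conformalDiff (hG : IsCoordMetric U G) (hs : ContDiffOn ℝ ∞ s U)
    (hs0 : ∀ z ∈ U, s z ≠ 0) (hy : y ∈ U) (c k i j : Fin (n + 1)) :
    pd c (christoffel (fun z => ((s z) ^ 2)⁻¹ • G z) k i j) y = pd c (christoffel G k i j) y +
      ((if k = i then pd c (upsilon s j) y else 0) + (if k = j then pd c (upsilon s i) y else 0)
        - (pd c (fun z => G z i j) y * upsilonUp G s k y
          + G y i j * pd c (upsilonUp G s k) y)) := by
  have hU := hG.isRelOpen
  have hif : ∀ (P : Prop) [Decidable P] (m : Fin (n + 1)),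
      ContDiffOn ℝ ∞ (fun z => if P then upsilon s m z else 0) U := by
    intro P _ m
    split_ifs
    · exact hG.smooth_upsilon hs hs0 m
    · exact contDiffOn_const
  have hpif : ∀ (P : Prop) [Decidable P] (m : Fin (n + 1)),
      pd c (fun z => if P then upsilon s m z else 0) y = if P then pd c (upsilon s m) y else 0 := by
    intro P _ m
    split_ifs
    · rfl
    · exact pd_const 0 c
  have hprod := (hG.smooth i j).mul (hG.smooth_upsilonUp hs hs0 k)
  rw [pd_congr hU (fun z hz => hG.christoffel_conformal hs hs0 hz k i j) c hy]
  simp only [conformalDiff]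
  rw [pd_add hU (hG.smooth_christoffel k i j) (((hif _ j).add (hif _ i)).sub hprod) c hy,
    pd_sub hU ((hif _ j).add (hif _ i)) hprod c hy, pd_add hU (hif _ j) (hif _ i) c hy,
    pd_mul hU (hG.smooth i j) (hG.smooth_upsilonUp hs hs0 k) c hy, hpif, hpif]
  ring

/-- The contracted Christoffel symbols under a conformal change. -/
theorem sum_pd_christoffel_conformal (hG : IsCoordMetric U G) (hs : ContDiffOn ℝ ∞ s U)
    (hs0 : ∀ z ∈ U, s z ≠ 0) (hy : y ∈ U) (a b : Fin (n + 1)) :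
    ∑ c, pd a (christoffel (fun z => ((s z) ^ 2)⁻¹ • G z) c c b) y =
      ∑ c, pd a (christoffel G c c b) y + ((n : ℝ) + 1) * pd a (upsilon s b) y := by
  have hU := hG.isRelOpen
  have hG' : IsCoordMetric U (fun z => ((s z) ^ 2)⁻¹ • G z) :=
    { isRelOpen := hU
      smooth := fun i j => ((hs.pow 2).inv fun z hz => pow_ne_zero _ (hs0 z hz)).mul (hG.smooth i j)
      symm := fun z hz i j => by simp [hG.symm z hz i j]
      det_ne_zero := fun z hz => by
        simpa [Matrix.det_smul, hs0 z hz] using hG.det_ne_zero z hz }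
  rw [← pd_sum _ hU (fun c => hG'.smooth_christoffel c c b) a hy,
    ← pd_sum _ hU (fun c => hG.smooth_christoffel c c b) a hy,
    ← pd_const_mul hU _ (hG.smooth_upsilon hs hs0 b) a hy,
    ← pd_add hU (ContDiffOn.sum fun c _ => hG.smooth_christoffel c c b)
      (contDiffOn_const.mul (hG.smooth_upsilon hs hs0 b)) a hy]
  -- The trace is evaluated as a function before it is differentiated, so no derivative of the
  -- metric enters.
  refine pd_congr hU (fun z hz => ?_) a hy
  simp only [hG.christoffel_conformal hs hs0 hz, Finset.sum_add_distrib]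
  rw [sum_conformalDiff_trace (hG.symm z hz) (fun a => hG.lower_upsilonUp hz a)]
  simp

/-- Nonvanishing is required on all of `U` so that `Υ` is smooth there; shrinking `U` removes this
restriction afterwards. -/
theorem ricci_conformal_of_ne_zero (hG : IsCoordMetric U G) (hs : ContDiffOn ℝ ∞ s U)
    (hs0 : ∀ z ∈ U, s z ≠ 0) (hy : y ∈ U) (a b : Fin (n + 1)) :
    ricci (fun z => ((s z) ^ 2)⁻¹ • G z) y a b = ricci G y a b
      + ((n : ℝ) - 1) * ((s y)⁻¹ * hess G s a b y)
      + ((s y)⁻¹ * lap G s y - n * ((s y)⁻¹) ^ 2 * gradSq G s y) * G y a b := by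
  have hU := hG.isRelOpen
  have hdv : ∀ a b, pd a (upsilon s b) y = pd b (upsilon s a) y := by
    intro a b
    rw [hG.pd_upsilon hs hs0 hy, hG.pd_upsilon hs hs0 hy, pd_comm hU hs a b hy]
    ring
  have key := ricci_contraction_conformal (Γ := fun k i j => christoffel G k i j y)
    (hG.christoffel_symm hy) (hG.symm y hy) (fun a => hG.lower_upsilonUp (s := s) hy a)
    (dw := fun a b => pd a (upsilonUp G s b) y) (dΓ := fun c k i j => pd c (christoffel G k i j) y)
    hdv (hG.pd_metric hy) a b
  have tr := hG.sum_pd_christoffel_conformal hs hs0 hy a b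
  have div := hG.div_upsilonUp hs hs0 hy
  simp only [Fintype.card_fin, Nat.cast_add, Nat.cast_one, hG.hess_upsilon hs hs0 hy,
    sum_upsilon_mul_upsilonUp] at key div
  rw [div] at key
  have tr2 : ∑ a, ∑ b, (G y)⁻¹ a b * (-((s y)⁻¹ * hess G s a b y) + upsilon s a y * upsilon s b y)
      = -((s y)⁻¹ * lap G s y) + ((s y)⁻¹) ^ 2 * gradSq G s y := by
    rw [← sub_eq_neg_add]
    simp only [lap, gradSq, Finset.mul_sum, ← Finset.sum_sub_distrib, upsilon]
    exact Finset.sum_congr rfl fun k _ => Finset.sum_congr rfl fun b _ => by ring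
  rw [tr2] at key
  simp only [ricci, riemann, Matrix.of_apply]
  simp only [hG.christoffel_conformal hs hs0 hy]
  simp only [Finset.sum_add_distrib, Finset.sum_sub_distrib] at key tr ⊢
  rw [tr]
  simp only [hG.pd_conformalDiff hs hs0 hy, Finset.sum_add_distrib, Finset.sum_sub_distrib]
  linear_combination key

/-- The Ricci tensor of `s^{-2} G`. -/
theorem ricci_conformal (hG : IsCoordMetric U G) (hs : ContDiffOn ℝ ∞ s U)
    (hy : y ∈ U) (hsy : s y ≠ 0) (a b : Fin (n + 1)) :
    ricci (fun z => ((s z) ^ 2)⁻¹ • G z) y a b = ricci G y a b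
      + ((n : ℝ) - 1) * ((s y)⁻¹ * hess G s a b y)
      + ((s y)⁻¹ * lap G s y - n * ((s y)⁻¹) ^ 2 * gradSq G s y) * G y a b :=
  (hG.restrict hs).ricci_conformal_of_ne_zero (hs.mono Set.inter_subset_left)
    (fun _ hz => hz.2) ⟨hy, hsy⟩ a b

end IsCoordMetric

end

/-! ### The tractor equations in coordinates -/

/-- The bottom slot `-(Δs + J s) / d` of the tractor determined by the scale `s`. -/
def coordRho {n : ℕ} (G : Coord n → Matrix (Fin (n + 1)) (Fin (n + 1)) ℝ) (s : Coord n → ℝ)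
    (y : Coord n) : ℝ :=
  -(lap G s y + scal G y / (2 * n) * s y) / (n + 1)

section

variable {n : ℕ} {U : Set (Coord n)} {G : Coord n → Matrix (Fin (n + 1)) (Fin (n + 1)) ℝ}
  {s ρ : Coord n → ℝ} {y : Coord n}

theorem scal_of_ricci_eq {T : Coord n → Matrix (Fin (n + 1)) (Fin (n + 1)) ℝ} {c : ℝ}
    (hsymm : ∀ i j, T y i j = T y j i) (hdet : (T y).det ≠ 0) (h : ricci T y = c • T y) :
    scal T y = c * (n + 1) := by
  have h1 : ∀ a, ∑ b, (T y)⁻¹ a b * T y a b = 1 := by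
    intro a
    have h := Matrix.nonsing_inv_mul (T y) (isUnit_iff_ne_zero.2 hdet)
    have h' := congrFun (congrFun h a) a
    rw [Matrix.mul_apply, Matrix.one_apply_eq] at h'
    rw [← h']
    exact Finset.sum_congr rfl fun b _ => by rw [hsymm a b]
  calc scal T y = ∑ a, c * ∑ b, (T y)⁻¹ a b * T y a b := by
        simp only [scal, h, Finset.mul_sum, Matrix.smul_apply, smul_eq_mul]
        exact Finset.sum_congr rfl fun k _ => Finset.sum_congr rfl fun b _ => by ring
    _ = c * (n + 1) := by simp [h1]; ring

namespace IsCoordMetric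

theorem smooth_coordRho (hG : IsCoordMetric U G) (hs : ContDiffOn ℝ ∞ s U) :
    ContDiffOn ℝ ∞ (coordRho G s) U :=
  ((hG.smooth_lap hs).add ((hG.smooth_scal.div_const _).mul hs)).neg.div_const _

theorem trace_metric (hG : IsCoordMetric U G) (hy : y ∈ U) :
    ∑ a, ∑ b, (G y)⁻¹ a b * G y a b = n + 1 := by
  have : ∀ a, ∑ b, (G y)⁻¹ a b * G y a b = 1 := by
    intro a
    have := hG.inv_mul hy a a
    rw [if_pos rfl] at this
    rw [← this]
    exact Finset.sum_congr rfl fun b _ => by rw [hG.symm y hy a b]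
  simp [this]

/-- With `S` the scalar curvature, `(S - (n+1) S/(2n))/(n-1) = S/(2n)`; the cancellation needs `n ≠
1`. -/
theorem trace_schouten (hG : IsCoordMetric U G) (hn : 2 ≤ n) (hy : y ∈ U) :
    ∑ a, ∑ b, (G y)⁻¹ a b * schouten G y a b = scal G y / (2 * n) := by
  have hn1 : (n : ℝ) - 1 ≠ 0 := by
    have : (2 : ℝ) ≤ n := by exact_mod_cast hn
    linarith
  have hn0 : (n : ℝ) ≠ 0 := by positivity
  have e : ∑ a, ∑ b, (G y)⁻¹ a b * schouten G y a b = ((n : ℝ) - 1)⁻¹ *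
      (∑ a, ∑ b, (G y)⁻¹ a b * ricci G y a b
        - scal G y / (2 * n) * ∑ a, ∑ b, (G y)⁻¹ a b * G y a b) := by
    simp only [schouten, Matrix.smul_apply, Matrix.sub_apply, smul_eq_mul, Finset.mul_sum,
      ← Finset.sum_sub_distrib]
    exact Finset.sum_congr rfl fun k _ => Finset.sum_congr rfl fun b _ => by ring
  rw [e, hG.trace_metric hy, ← scal]
  field_simp
  ring

theorem ricci_eq_schouten (hn : 2 ≤ n) (a b : Fin (n + 1)) :
    ricci G y a b = ((n : ℝ) - 1) * schouten G y a b + scal G y / (2 * n) * G y a b := by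
  have hn1 : (n : ℝ) - 1 ≠ 0 := by
    have : (2 : ℝ) ≤ n := by exact_mod_cast hn
    linarith
  simp only [schouten, Matrix.smul_apply, Matrix.sub_apply, smul_eq_mul]
  field_simp
  ring

/-- If the first two slots of the tractor derivative of `(s, ds, r)` vanish, then `s^{-2} G` is
Einstein. -/
theorem ricci_eq_of_hess (hG : IsCoordMetric U G) (hn : 2 ≤ n) (hs : ContDiffOn ℝ ∞ s U)
    (hy : y ∈ U) (hsy : s y ≠ 0) {r : ℝ}
    (h : ∀ a b, hess G s a b y + G y a b * r + schouten G y a b * s y = 0) :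
    ricci (fun z => ((s z) ^ 2)⁻¹ • G z) y =
      (-(n : ℝ) * (2 * r * s y + gradSq G s y)) • (((s y) ^ 2)⁻¹ • G y) := by
  -- The trace of `h` gives the Laplacian, so both the Hessian and its trace can be eliminated from
  -- `ricci_conformal`.
  have hlap : lap G s y = -((n + 1) * r) - scal G y / (2 * n) * s y := by
    have e : ∑ a, ∑ b, (G y)⁻¹ a b *
        (hess G s a b y + G y a b * r + schouten G y a b * s y) = 0 := by simp [h]
    have e' : ∑ a, ∑ b, (G y)⁻¹ a b *
        (hess G s a b y + G y a b * r + schouten G y a b * s y)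
        = lap G s y + (∑ a, ∑ b, (G y)⁻¹ a b * G y a b) * r
          + (∑ a, ∑ b, (G y)⁻¹ a b * schouten G y a b) * s y := by
      simp only [lap, Finset.sum_mul, ← Finset.sum_add_distrib]
      exact Finset.sum_congr rfl fun k _ => Finset.sum_congr rfl fun b _ => by ring
    rw [e', hG.trace_metric hy, hG.trace_schouten hn hy] at e
    linarith
  ext a b
  rw [hG.ricci_conformal hs hy hsy, ricci_eq_schouten hn, hlap]
  have hh : hess G s a b y = -(G y a b * r) - schouten G y a b * s y := by linarith [h a b]
  rw [hh]
  simp only [Matrix.smul_apply, smul_eq_mul]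
  field_simp
  ring

/-- If `Ric(s^{-2} G) = -n s^{-2} G`, then the middle slot of the tractor derivative of
`(s, ds, -(Δs + J s) / d)` vanishes, and this tractor has length one. -/
theorem hess_of_ricci_eq (hG : IsCoordMetric U G) (hn : 2 ≤ n) (hs : ContDiffOn ℝ ∞ s U)
    (hy : y ∈ U) (hsy : s y ≠ 0)
    (h : ricci (fun z => ((s z) ^ 2)⁻¹ • G z) y = (-(n : ℝ)) • (((s y) ^ 2)⁻¹ • G y)) :
    (∀ a b, hess G s a b y + G y a b * coordRho G s y + schouten G y a b * s y = 0) ∧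
      2 * coordRho G s y * s y + gradSq G s y = 1 := by
  have hn1 : (n : ℝ) - 1 ≠ 0 := by
    have : (2 : ℝ) ≤ n := by exact_mod_cast hn
    linarith
  have hn0 : (n : ℝ) ≠ 0 := by positivity
  have hn2 : (n : ℝ) + 1 ≠ 0 := by positivity
  -- The Einstein equation multiplied by `s²`, with all multiples of `G` collected on the right;
  -- `h2` is its trace.
  have h1 : ∀ a b, ((n : ℝ) - 1) * s y * (hess G s a b y + schouten G y a b * s y) =
      G y a b * (-n - scal G y / (2 * n) * (s y) ^ 2 - s y * lap G s y + n * gradSq G s y) := by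
    intro a b
    have e := congrFun (congrFun h a) b
    rw [hG.ricci_conformal hs hy hsy, ricci_eq_schouten hn] at e
    simp only [Matrix.smul_apply, smul_eq_mul] at e
    field_simp at e ⊢
    linarith
  have h2 : ((n : ℝ) - 1) * s y * (lap G s y + scal G y / (2 * n) * s y) =
      (n + 1) * (-n - scal G y / (2 * n) * (s y) ^ 2 - s y * lap G s y + n * gradSq G s y) := by
    have e : ∑ a, ∑ b, (G y)⁻¹ a b *
        (((n : ℝ) - 1) * s y * (hess G s a b y + schouten G y a b * s y)) =
        ((n : ℝ) - 1) * s y * (lap G s y + (∑ a, ∑ b, (G y)⁻¹ a b * schouten G y a b) * s y) := by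
      simp only [lap, Finset.sum_mul, Finset.mul_sum, ← Finset.sum_add_distrib]
      exact Finset.sum_congr rfl fun k _ => Finset.sum_congr rfl fun b _ => by ring
    rw [hG.trace_schouten hn hy] at e
    rw [← e]
    simp only [h1]
    rw [← hG.trace_metric hy]
    simp only [Finset.sum_mul]
    exact Finset.sum_congr rfl fun k _ => Finset.sum_congr rfl fun b _ => by ring
  -- The trace identifies the factor of `G` in `h1`. This one identity gives the Hessian equation
  -- through `h1` and, once the Laplacian is eliminated, `n (2ρs + |ds|²) = n`.
  have h3 : -n - scal G y / (2 * n) * (s y) ^ 2 - s y * lap G s y + n * gradSq G s y =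
      -((n : ℝ) - 1) * s y * coordRho G s y := by
    rw [coordRho]
    generalize scal G y / (2 * n) = J at *
    field_simp
    linarith
  refine ⟨fun a b => ?_, ?_⟩
  · have e := h1 a b
    rw [h3] at e
    have : ((n : ℝ) - 1) * s y ≠ 0 := mul_ne_zero hn1 hsy
    apply mul_left_cancel₀ this
    linear_combination e
  · apply mul_left_cancel₀ hn0
    have h4 : lap G s y = -(n + 1) * coordRho G s y - scal G y / (2 * n) * s y := by
      rw [coordRho]
      field_simp
      ring
    rw [h4] at h3
    linear_combination h3

/-- Metric compatibility: the Christoffel terms from differentiating `G⁻¹` are those that complete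
the two second derivatives to Hessians. -/
theorem pd_gradSq (hG : IsCoordMetric U G) (hs : ContDiffOn ℝ ∞ s U) (hy : y ∈ U)
    (a : Fin (n + 1)) :
    pd a (gradSq G s) y = 2 * ∑ b, ∑ c, (G y)⁻¹ b c * pd c s y * hess G s a b y := by
  have hU := hG.isRelOpen
  have hd := fun b => contDiffOn_pd hU hs b
  have e1 : pd a (gradSq G s) y = ∑ b, ∑ c,
      ((G y)⁻¹ b c * pd b s y * pd a (pd c s) y + pd c s y * ((G y)⁻¹ b c * pd a (pd b s) y
        + pd b s y * pd a (fun z => (G z)⁻¹ b c) y)) := by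
    change pd a (fun z => ∑ b, ∑ c, (G z)⁻¹ b c * pd b s z * pd c s z) y = _
    rw [pd_sum _ hU (fun b => ContDiffOn.sum fun c _ =>
      ((hG.smooth_inv b c).mul (hd b)).mul (hd c)) a hy]
    refine Finset.sum_congr rfl fun b _ => ?_
    rw [pd_sum _ hU (fun c => ((hG.smooth_inv b c).mul (hd b)).mul (hd c)) a hy]
    refine Finset.sum_congr rfl fun c _ => ?_
    rw [pd_mul hU ((hG.smooth_inv b c).mul (hd b)) (hd c) a hy,
      pd_mul hU (hG.smooth_inv b c) (hd b) a hy]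
  have e2 : ∑ b, ∑ c, (G y)⁻¹ b c * pd b s y * pd a (pd c s) y
      = ∑ b, ∑ c, (G y)⁻¹ b c * pd c s y * pd a (pd b s) y := by
    rw [Finset.sum_comm]
    exact Finset.sum_congr rfl fun k _ => Finset.sum_congr rfl fun b _ => by
      rw [hG.inv_symm hy b k]
  have e3 : ∑ b, ∑ c, pd c s y * (pd b s y * ∑ e, christoffel G b a e y * (G y)⁻¹ e c)
      = ∑ b, ∑ c, (G y)⁻¹ b c * pd c s y * ∑ e, christoffel G e a b y * pd e s y := by
    have : ∀ b, ∑ c, pd c s y * (pd b s y * ∑ e, christoffel G b a e y * (G y)⁻¹ e c)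
        = ∑ e, ∑ c, (G y)⁻¹ e c * pd c s y * (christoffel G b a e y * pd b s y) := by
      intro b
      simp only [Finset.mul_sum]
      rw [Finset.sum_comm]
      exact Finset.sum_congr rfl fun k _ => Finset.sum_congr rfl fun c _ => by ring
    simp only [this]
    rw [Finset.sum_comm]
    refine Finset.sum_congr rfl fun k _ => ?_
    rw [Finset.sum_comm]
    simp only [Finset.mul_sum]
  have e4 : ∑ b, ∑ c, pd c s y * (pd b s y * ∑ e, christoffel G c a e y * (G y)⁻¹ e b)
      = ∑ b, ∑ c, (G y)⁻¹ b c * pd c s y * ∑ e, christoffel G e a b y * pd e s y := by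
    rw [← e3, Finset.sum_comm]
    exact Finset.sum_congr rfl fun k _ => Finset.sum_congr rfl fun b _ => by ring
  rw [e1]
  simp only [hG.pd_inv_metric hy, hess, mul_sub, mul_add, mul_neg, Finset.sum_add_distrib,
    Finset.sum_sub_distrib, Finset.sum_neg_distrib, e2, e3, e4]
  have e5 : ∑ b, ∑ c, pd c s y * ((G y)⁻¹ b c * pd a (pd b s) y)
      = ∑ b, ∑ c, (G y)⁻¹ b c * pd c s y * pd a (pd b s) y :=
    Finset.sum_congr rfl fun k _ => Finset.sum_congr rfl fun b _ => by ring
  rw [e5]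
  ring

/-- The bottom slot of the tractor derivative of `(s, ds, ρ)` vanishes where `s ≠ 0` if the middle
slot does and the tractor has length one. -/
theorem pd_rho (hG : IsCoordMetric U G) (hs : ContDiffOn ℝ ∞ s U) (hρ : ContDiffOn ℝ ∞ ρ U)
    (hy : y ∈ U) (hsy : s y ≠ 0)
    (h : ∀ a b, hess G s a b y + G y a b * ρ y + schouten G y a b * s y = 0)
    (hlen : ∀ z ∈ U, 2 * ρ z * s z + gradSq G s z = 1) (a : Fin (n + 1)) :
    pd a ρ y - ∑ b, ∑ e, schouten G y a b * (G y)⁻¹ b e * pd e s y = 0 := by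
  have hU := hG.isRelOpen
  have e1 : pd a (fun z => 2 * ρ z * s z + gradSq G s z) y = 0 := by
    rw [pd_congr hU hlen a hy, pd_const]
  rw [pd_add hU ((contDiffOn_const.mul hρ).mul hs) (hG.smooth_gradSq hs) a hy,
    pd_mul hU (contDiffOn_const.mul hρ) hs a hy, pd_const_mul hU 2 hρ a hy,
    hG.pd_gradSq hs hy] at e1
  -- Inserting the Hessian equation into the derivative of the length cancels `ρ ∂_a s` and leaves
  -- `s` times the bottom slot.
  have e2 : ∑ b, ∑ c, (G y)⁻¹ b c * pd c s y * hess G s a b y =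
      -(ρ y * pd a s y) - s y * ∑ b, ∑ e, schouten G y a b * (G y)⁻¹ b e * pd e s y := by
    have hh : ∀ b, hess G s a b y = -(G y a b * ρ y) - schouten G y a b * s y := fun b => by
      linarith [h a b]
    have e3 : ∑ b, ∑ c, (G y)⁻¹ b c * pd c s y * (G y a b * ρ y) = ρ y * pd a s y := by
      rw [Finset.sum_comm]
      calc _ = ∑ c, ρ y * pd c s y * ∑ b, G y a b * (G y)⁻¹ b c := by
            simp only [Finset.mul_sum]
            exact Finset.sum_congr rfl fun k _ => Finset.sum_congr rfl fun b _ => by ring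
        _ = _ := by simp [hG.mul_inv hy]
    simp only [hh, mul_sub, mul_neg, Finset.sum_sub_distrib, Finset.sum_neg_distrib, e3]
    congr 1
    simp only [Finset.mul_sum]
    exact Finset.sum_congr rfl fun k _ => Finset.sum_congr rfl fun b _ => by ring
  rw [e2] at e1
  apply mul_left_cancel₀ hsy
  linear_combination e1 / 2

end IsCoordMetric

end

/-! ## Components in charts of the maximal atlas -/

section

variable {n : ℕ} {M : Type*} [TopologicalSpace M]
  {φ : OpenPartialHomeomorph M (EuclideanHalfSpace (n + 1))} {y : Coord n}

theorem isRelOpen_target (φ : OpenPartialHomeomorph M (EuclideanHalfSpace (n + 1))) :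
    IsRelOpen (φ.extend (𝓡∂ (n + 1))).target where
  subset := φ.extend_target_subset_range
  mem_nhdsWithin := fun y hy => by
    have h := (φ.extend (𝓡∂ (n + 1))).map_target hy
    rw [φ.extend_source] at h
    have := φ.extend_target_mem_nhdsWithin (I := 𝓡∂ (n + 1)) h
    rwa [(φ.extend (𝓡∂ (n + 1))).right_inv hy] at this

theorem symm_mem_source (hy : y ∈ (φ.extend (𝓡∂ (n + 1))).target) :
    (φ.extend (𝓡∂ (n + 1))).symm y ∈ φ.source := by
  have h := (φ.extend (𝓡∂ (n + 1))).map_target hy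
  rwa [φ.extend_source] at h

variable [ChartedSpace (EuclideanHalfSpace (n + 1)) M]

theorem contMDiffOn_symm_target (hφ : φ ∈ IsManifold.maximalAtlas (𝓡∂ (n + 1)) ∞ M) :
    ContMDiffOn 𝓘(ℝ, Coord n) (𝓡∂ (n + 1)) ∞ (φ.extend (𝓡∂ (n + 1))).symm
      (φ.extend (𝓡∂ (n + 1))).target := by
  rw [φ.extend_target']
  exact contMDiffOn_extend_symm hφ

theorem mdifferentiableWithinAt_symm (hφ : φ ∈ IsManifold.maximalAtlas (𝓡∂ (n + 1)) ∞ M)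
    (hy : y ∈ (φ.extend (𝓡∂ (n + 1))).target) :
    MDifferentiableWithinAt 𝓘(ℝ, Coord n) (𝓡∂ (n + 1)) (φ.extend (𝓡∂ (n + 1))).symm
      (Set.range (𝓡∂ (n + 1))) y :=
  ((contMDiffOn_symm_target hφ y hy).mdifferentiableWithinAt (by simp)).mono_of_mem_nhdsWithin
    ((isRelOpen_target φ).mem_nhdsWithin y hy)

theorem uniqueMDiffWithinAt_target (hy : y ∈ (φ.extend (𝓡∂ (n + 1))).target) :
    UniqueMDiffWithinAt 𝓘(ℝ, Coord n) (Set.range (𝓡∂ (n + 1))) y :=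
  ((isRelOpen_target φ).uniqueDiffWithinAt hy).uniqueMDiffWithinAt

theorem uniqueMDiffOn_target (φ : OpenPartialHomeomorph M (EuclideanHalfSpace (n + 1))) :
    UniqueMDiffOn 𝓘(ℝ, Coord n) (φ.extend (𝓡∂ (n + 1))).target := by
  intro y hy
  exact (uniqueMDiffWithinAt_target hy).mono_nhds
    (nhdsWithin_le_of_mem ((isRelOpen_target φ).mem_nhdsWithin y hy))

variable [IsManifold (𝓡∂ (n + 1)) ∞ M]

/-- The coordinate field is the tangent map of the inverse chart applied to a constant section.
Derivatives within the target and within the half space agree, as the target is relatively open. -/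
theorem contMDiffOn_coordVec (hφ : φ ∈ IsManifold.maximalAtlas (𝓡∂ (n + 1)) ∞ M)
    (i : Fin (n + 1)) :
    ContMDiffOn 𝓘(ℝ, Coord n) (𝓡∂ (n + 1)).tangent ∞
      (fun y => (⟨(φ.extend (𝓡∂ (n + 1))).symm y, coordVec φ i y⟩ :
        TangentBundle (𝓡∂ (n + 1)) M)) (φ.extend (𝓡∂ (n + 1))).target := by
  have h := (contMDiffOn_symm_target hφ).contMDiffOn_tangentMapWithin (m := ∞) (by simp)
    (uniqueMDiffOn_target φ)
  have hc := contMDiff_vectorSpace_iff_contDiff (𝕜 := ℝ) (n := ∞)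
    (V := fun _ : Coord n => (EuclideanSpace.single i (1 : ℝ) : Coord n)).2 contDiff_const
  refine (h.comp hc.contMDiffOn (fun y hy => hy)).congr fun y hy => ?_
  simp only [Function.comp, tangentMapWithin, coordVec]
  congr 2
  exact MDifferentiableWithinAt.mfderivWithin_mono_of_mem_nhdsWithin
    ((contMDiffOn_symm_target hφ y hy).mdifferentiableWithinAt (by simp))
    (uniqueMDiffWithinAt_target hy) ((isRelOpen_target φ).mem_nhdsWithin y hy)

theorem contDiffOn_comp₀ (hφ : φ ∈ IsManifold.maximalAtlas (𝓡∂ (n + 1)) ∞ M)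
    (f : SmoothFun n M) : ContDiffOn ℝ ∞ (comp₀ φ f) (φ.extend (𝓡∂ (n + 1))).target := by
  rw [← contMDiffOn_iff_contDiffOn]
  exact f.contMDiff.comp_contMDiffOn (contMDiffOn_symm_target hφ)

theorem contDiffOn_comp₁ (hφ : φ ∈ IsManifold.maximalAtlas (𝓡∂ (n + 1)) ∞ M)
    (α : OneForm n M) (i : Fin (n + 1)) :
    ContDiffOn ℝ ∞ (comp₁ φ α i) (φ.extend (𝓡∂ (n + 1))).target := by
  rw [← contMDiffOn_iff_contDiffOn]
  intro y hy
  have h := ContMDiffWithinAt.clm_bundle_apply (E₂ := Bundle.Trivial M ℝ)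
    ((α.contMDiff _).comp_contMDiffWithinAt y (contMDiffOn_symm_target hφ y hy))
    (contMDiffOn_coordVec hφ i y hy)
  exact (Bundle.contMDiffWithinAt_totalSpace.1 h).2

theorem contDiffOn_comp₂ (hφ : φ ∈ IsManifold.maximalAtlas (𝓡∂ (n + 1)) ∞ M)
    (g : Metric n M) (i j : Fin (n + 1)) :
    ContDiffOn ℝ ∞ (fun y => comp₂ φ g.inner y i j) (φ.extend (𝓡∂ (n + 1))).target := by
  rw [← contMDiffOn_iff_contDiffOn]
  intro y hy
  have h := ContMDiffWithinAt.clm_bundle_apply₂ (E₃ := Bundle.Trivial M ℝ)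
    ((g.contMDiff _).comp_contMDiffWithinAt y (contMDiffOn_symm_target hφ y hy))
    (contMDiffOn_coordVec hφ i y hy) (contMDiffOn_coordVec hφ j y hy)
  exact (Bundle.contMDiffWithinAt_totalSpace.1 h).2

theorem pd_comp₀ (hφ : φ ∈ IsManifold.maximalAtlas (𝓡∂ (n + 1)) ∞ M) (f : SmoothFun n M)
    (hy : y ∈ (φ.extend (𝓡∂ (n + 1))).target) (i : Fin (n + 1)) :
    pd i (comp₀ φ f) y = dAt f ((φ.extend (𝓡∂ (n + 1))).symm y) (coordVec φ i y) := by
  have hf : MDifferentiableAt (𝓡∂ (n + 1)) 𝓘(ℝ, ℝ) f ((φ.extend (𝓡∂ (n + 1))).symm y) :=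
    f.contMDiff.mdifferentiableAt (by simp)
  have h := mfderiv_comp_mfderivWithin y hf (mdifferentiableWithinAt_symm hφ hy)
    (uniqueMDiffWithinAt_target hy)
  rw [pd, ← mfderivWithin_eq_fderivWithin]
  change mfderivWithin _ _ (f ∘ (φ.extend (𝓡∂ (n + 1))).symm) _ _ _ = _
  rw [h]
  rfl

/-- By the chain rule the derivative of the chart is a left inverse. This is what makes the
coordinate vectors a basis, also at boundary points. -/
theorem mfderivWithin_symm_injective (hφ : φ ∈ IsManifold.maximalAtlas (𝓡∂ (n + 1)) ∞ M)
    (hy : y ∈ (φ.extend (𝓡∂ (n + 1))).target) :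
    Function.Injective (mfderivWithin 𝓘(ℝ, Coord n) (𝓡∂ (n + 1)) (φ.extend (𝓡∂ (n + 1))).symm
      (Set.range (𝓡∂ (n + 1))) y) := by
  have hd : MDifferentiableAt (𝓡∂ (n + 1)) 𝓘(ℝ, Coord n) (φ.extend (𝓡∂ (n + 1)))
      ((φ.extend (𝓡∂ (n + 1))).symm y) :=
    (φ.contMDiffAt_extend hφ (symm_mem_source hy)).mdifferentiableAt (by simp)
  have U := uniqueMDiffWithinAt_target hy
  have h := mfderiv_comp_mfderivWithin y hd (mdifferentiableWithinAt_symm hφ hy) U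
  have h2 : mfderivWithin 𝓘(ℝ, Coord n) 𝓘(ℝ, Coord n)
      (φ.extend (𝓡∂ (n + 1)) ∘ (φ.extend (𝓡∂ (n + 1))).symm) (Set.range (𝓡∂ (n + 1))) y =
      ContinuousLinearMap.id ℝ _ := by
    rw [← mfderivWithin_id U]
    apply Filter.EventuallyEq.mfderivWithin_eq
    · filter_upwards [(isRelOpen_target φ).mem_nhdsWithin y hy] with z hz
      exact (φ.extend (𝓡∂ (n + 1))).right_inv hz
    · exact (φ.extend (𝓡∂ (n + 1))).right_inv hy
  rw [h] at h2
  exact Function.LeftInverse.injective (g := mfderiv (𝓡∂ (n + 1)) 𝓘(ℝ, Coord n)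
    (φ.extend (𝓡∂ (n + 1))) ((φ.extend (𝓡∂ (n + 1))).symm y)) fun v => congrArg (fun f => f v) h2

/-- The basis of coordinate vector fields. -/
def coordBasis (hφ : φ ∈ IsManifold.maximalAtlas (𝓡∂ (n + 1)) ∞ M)
    (hy : y ∈ (φ.extend (𝓡∂ (n + 1))).target) :
    Module.Basis (Fin (n + 1)) ℝ (TangentSpace (𝓡∂ (n + 1)) ((φ.extend (𝓡∂ (n + 1))).symm y)) :=
  haveI : FiniteDimensional ℝ (TangentSpace (𝓡∂ (n + 1)) ((φ.extend (𝓡∂ (n + 1))).symm y)) :=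
    inferInstanceAs (FiniteDimensional ℝ (Coord n))
  (EuclideanSpace.basisFun (Fin (n + 1)) ℝ).toBasis.map
    (LinearMap.linearEquivOfInjective
      (mfderivWithin 𝓘(ℝ, Coord n) (𝓡∂ (n + 1)) (φ.extend (𝓡∂ (n + 1))).symm
        (Set.range (𝓡∂ (n + 1))) y).toLinearMap (mfderivWithin_symm_injective hφ hy) rfl)

theorem coordBasis_apply (hφ : φ ∈ IsManifold.maximalAtlas (𝓡∂ (n + 1)) ∞ M)
    (hy : y ∈ (φ.extend (𝓡∂ (n + 1))).target) (i : Fin (n + 1)) :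
    coordBasis hφ hy i = coordVec φ i y := by
  simp only [coordBasis, Module.Basis.map_apply, OrthonormalBasis.coe_toBasis,
    EuclideanSpace.basisFun_apply]
  rfl

end

section

variable {n : ℕ} {M : Type*} [TopologicalSpace M] [ChartedSpace (EuclideanHalfSpace (n + 1)) M]
  [IsManifold (𝓡∂ (n + 1)) ∞ M]
  {φ : OpenPartialHomeomorph M (EuclideanHalfSpace (n + 1))} {y : Coord n}

theorem contMDiff_of_comp₀ {f : M → ℝ}
    (hf : ∀ φ ∈ IsManifold.maximalAtlas (𝓡∂ (n + 1)) ∞ M,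
      ContDiffOn ℝ ∞ (comp₀ φ f) (φ.extend (𝓡∂ (n + 1))).target) :
    ContMDiff (𝓡∂ (n + 1)) 𝓘(ℝ, ℝ) ∞ f := by
  intro p
  set φ := chartAt (EuclideanHalfSpace (n + 1)) p with hφdef
  have hφ : φ ∈ IsManifold.maximalAtlas (𝓡∂ (n + 1)) ∞ M := IsManifold.chart_mem_maximalAtlas p
  have h1 : ContMDiffOn (𝓡∂ (n + 1)) 𝓘(ℝ, ℝ) ∞
      (comp₀ φ f ∘ φ.extend (𝓡∂ (n + 1))) φ.source := by
    refine (hf φ hφ).contMDiffOn.comp (φ.contMDiffOn_extend hφ) fun q hq => ?_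
    exact (φ.extend (𝓡∂ (n + 1))).map_source (by rwa [φ.extend_source])
  have h2 : ContMDiffOn (𝓡∂ (n + 1)) 𝓘(ℝ, ℝ) ∞ f φ.source := by
    refine h1.congr fun q hq => ?_
    simp only [Function.comp, comp₀]
    rw [φ.extend_left_inv hq]
  exact h2.contMDiffAt (φ.open_source.mem_nhds (mem_chart_source _ p))

/-! ### Density of the interior -/

theorem isInteriorPoint_of_chartAt (p : M) {z : Coord n}
    (hz : z ∈ ((chartAt (EuclideanHalfSpace (n + 1)) p).extend (𝓡∂ (n + 1))).target)
    (hz0 : 0 < z 0) :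
    ((chartAt (EuclideanHalfSpace (n + 1)) p).extend (𝓡∂ (n + 1))).symm z ∉
      (𝓡∂ (n + 1)).boundary M := by
  set φ := chartAt (EuclideanHalfSpace (n + 1)) p with hφdef
  have hs := symm_mem_source hz
  rw [← Set.mem_compl_iff, ModelWithCorners.compl_boundary]
  refine (ModelWithCorners.isInteriorPoint_iff_of_mem_atlas (n := ∞) (by simp)
    (chart_mem_atlas _ p) hs).2 ?_
  refine φ.mem_interior_extend_target ?_ ?_
  · exact φ.map_source hs
  · have : φ.extend (𝓡∂ (n + 1)) ((φ.extend (𝓡∂ (n + 1))).symm z) = z :=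
      (φ.extend (𝓡∂ (n + 1))).right_inv hz
    have h : φ.extend (𝓡∂ (n + 1)) ((φ.extend (𝓡∂ (n + 1))).symm z) ∈
        interior (Set.range (𝓡∂ (n + 1))) := by
      rw [this, interior_range_modelWithCornersEuclideanHalfSpace]
      exact hz0
    exact h

variable (n M) in
-- In a chart, every point of the half space is a limit of points with positive zeroth coordinate,
-- and these are interior points of `M`.
theorem dense_compl_boundary : Dense ((𝓡∂ (n + 1)).boundary M)ᶜ := by
  intro p
  rw [mem_closure_iff_nhds]
  intro t ht
  set φ := chartAt (EuclideanHalfSpace (n + 1)) p with hφdef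
  have hp : p ∈ φ.source := mem_chart_source _ p
  set y := φ.extend (𝓡∂ (n + 1)) p with hydef
  have hy : y ∈ (φ.extend (𝓡∂ (n + 1))).target :=
    (φ.extend (𝓡∂ (n + 1))).map_source (by rwa [φ.extend_source])
  have h1 : (φ.extend (𝓡∂ (n + 1))).symm ⁻¹' t ∈ 𝓝[Set.range (𝓡∂ (n + 1))] y :=
    mem_nhdsWithin_of_mem_nhds (φ.extend_preimage_mem_nhds hp ht)
  have h2 := inter_mem h1 ((isRelOpen_target φ).mem_nhdsWithin y hy)
  obtain ⟨o, ho, hyo, hsub⟩ := mem_nhdsWithin.1 h2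
  have hcl := (𝓡∂ (n + 1)).range_subset_closure_interior ((isRelOpen_target φ).subset hy)
  obtain ⟨z, hzo, hz⟩ := mem_closure_iff_nhds.1 hcl o (ho.mem_nhds hyo)
  have hz' := hsub ⟨hzo, interior_subset hz⟩
  rw [interior_range_modelWithCornersEuclideanHalfSpace] at hz
  exact ⟨_, hz'.1, isInteriorPoint_of_chartAt p hz'.2 hz⟩

/-- The device that carries identities proved where `σ ≠ 0` across the boundary. -/
theorem eq_zero_of_eq_zero_on_compl_boundary {O : Set M} (hO : IsOpen O) {F : M → ℝ}
    (hF : ContinuousOn F O) (h : ∀ p ∈ O, p ∉ (𝓡∂ (n + 1)).boundary M → F p = 0) {p : M}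
    (hp : p ∈ O) : F p = 0 := by
  have hcl : p ∈ closure (O ∩ ((𝓡∂ (n + 1)).boundary M)ᶜ) :=
    (dense_compl_boundary n M).open_subset_closure_inter hO hp
  have hcw : ContinuousWithinAt F (O ∩ ((𝓡∂ (n + 1)).boundary M)ᶜ) p :=
    (hF p hp).mono Set.inter_subset_left
  have hmem := hcw.mem_closure (t := {0}) hcl fun q hq => h q hq.1 hq.2
  rwa [closure_singleton] at hmem

theorem continuousOn_comp_extend {F : Coord n → ℝ}
    (hF : ContinuousOn F (φ.extend (𝓡∂ (n + 1))).target) :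
    ContinuousOn (F ∘ φ.extend (𝓡∂ (n + 1))) φ.source := by
  have := hF.comp (φ.continuousOn_extend (I := 𝓡∂ (n + 1))) (φ.extend (𝓡∂ (n + 1))).mapsTo
  rwa [φ.extend_source] at this

theorem extend_mem_target {p : M} (hp : p ∈ φ.source) :
    φ.extend (𝓡∂ (n + 1)) p ∈ (φ.extend (𝓡∂ (n + 1))).target :=
  (φ.extend (𝓡∂ (n + 1))).map_source (by rwa [φ.extend_source])

theorem eq_zero_of_eq_zero_on_interior {F : Coord n → ℝ}
    (hF : ContinuousOn F (φ.extend (𝓡∂ (n + 1))).target)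
    (h : ∀ z ∈ (φ.extend (𝓡∂ (n + 1))).target,
      (φ.extend (𝓡∂ (n + 1))).symm z ∉ (𝓡∂ (n + 1)).boundary M → F z = 0)
    (hy : y ∈ (φ.extend (𝓡∂ (n + 1))).target) : F y = 0 := by
  have := eq_zero_of_eq_zero_on_compl_boundary φ.open_source (continuousOn_comp_extend hF)
    (fun q hq hqb => h _ (extend_mem_target hq) (by rwa [φ.extend_left_inv hq]))
    (symm_mem_source hy)
  rwa [Function.comp, (φ.extend (𝓡∂ (n + 1))).right_inv hy] at this

/-! ### The metric in coordinates -/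

theorem comp₂_eq (hφ : φ ∈ IsManifold.maximalAtlas (𝓡∂ (n + 1)) ∞ M) (g : Metric n M)
    (hy : y ∈ (φ.extend (𝓡∂ (n + 1))).target) (i j : Fin (n + 1)) :
    comp₂ φ g.inner y i j = g.inner _ (coordBasis hφ hy i) (coordBasis hφ hy j) := by
  rw [coordBasis_apply, coordBasis_apply]
  rfl

/-- A kernel vector of the component matrix would be a nonzero tangent vector of length zero. -/
theorem det_comp₂_ne_zero (hφ : φ ∈ IsManifold.maximalAtlas (𝓡∂ (n + 1)) ∞ M) (g : Metric n M)
    (hy : y ∈ (φ.extend (𝓡∂ (n + 1))).target) : (comp₂ φ g.inner y).det ≠ 0 := by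
  intro h
  obtain ⟨v, hv, hv0⟩ := Matrix.exists_mulVec_eq_zero_iff.2 h
  set b := coordBasis hφ hy
  set V := ∑ i, v i • b i with hV
  have hVne : V ≠ 0 := by
    intro h0
    apply hv
    ext i
    have := Fintype.linearIndependent_iff.1 b.linearIndependent v h0 i
    simpa using this
  have h1 : ∀ i, g.inner _ (b i) V = 0 := by
    intro i
    have := congrFun hv0 i
    rw [hV, map_sum]
    simp only [map_smul, smul_eq_mul]
    simp only [Matrix.mulVec, dotProduct, comp₂_eq hφ g hy, Pi.zero_apply] at this
    rw [← this]
    exact Finset.sum_congr rfl fun j _ => mul_comm _ _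
  have h2 : g.inner _ V (∑ i, v i • b i) = 0 := by
    rw [map_sum]
    refine Finset.sum_eq_zero fun i _ => ?_
    rw [map_smul, g.symm, h1, smul_zero]
  exact (g.pos _ V hVne).ne' h2

theorem isCoordMetric (hφ : φ ∈ IsManifold.maximalAtlas (𝓡∂ (n + 1)) ∞ M) (g : Metric n M) :
    IsCoordMetric (φ.extend (𝓡∂ (n + 1))).target (comp₂ φ g.inner) where
  isRelOpen := isRelOpen_target φ
  smooth := contDiffOn_comp₂ hφ g
  symm := fun _ _ _ _ => g.symm _ _ _
  det_ne_zero := fun _ hz => det_comp₂_ne_zero hφ g hz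

/-- The components of the vector dual to `β` solve a linear system with matrix `G`, hence are `G⁻¹`
applied to those of `β`. -/
theorem cometric_eq_sum (hφ : φ ∈ IsManifold.maximalAtlas (𝓡∂ (n + 1)) ∞ M) (g : Metric n M)
    (hy : y ∈ (φ.extend (𝓡∂ (n + 1))).target)
    (α β : TangentSpace (𝓡∂ (n + 1)) ((φ.extend (𝓡∂ (n + 1))).symm y) →L[ℝ] ℝ) :
    cometric g _ α β = ∑ a, ∑ b,
      (comp₂ φ g.inner y)⁻¹ a b * α (coordVec φ a y) * β (coordVec φ b y) := by
  have hG := isCoordMetric hφ g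
  set b := coordBasis hφ hy with hb
  set V := (flat g _).symm β.toLinearMap with hV
  set c := fun i => b.repr V i with hc
  have hVs : V = ∑ i, c i • b i := (b.sum_repr V).symm
  have h1 : ∀ j, β (b j) = ∑ i, comp₂ φ g.inner y j i * c i := by
    intro j
    have h := flat_symm_apply g _ β.toLinearMap (b j)
    rw [← hV, g.symm, hVs, map_sum] at h
    change _ = β (b j) at h
    rw [← h]
    refine Finset.sum_congr rfl fun i _ => ?_
    rw [map_smul, comp₂_eq hφ g hy, smul_eq_mul, mul_comm]
  have h2 : ∀ a, ∑ k, (comp₂ φ g.inner y)⁻¹ a k * β (b k) = c a := by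
    intro a
    simp only [h1, Finset.mul_sum]
    rw [Finset.sum_comm]
    calc _ = ∑ i, (∑ k, (comp₂ φ g.inner y)⁻¹ a k * comp₂ φ g.inner y k i) * c i := by
          simp only [Finset.sum_mul]
          exact Finset.sum_congr rfl fun k _ => Finset.sum_congr rfl fun b _ => by ring
      _ = _ := by simp [hG.inv_mul hy]
  calc cometric g _ α β = α V := rfl
    _ = ∑ a, c a * α (b a) := by
        rw [hVs, map_sum]
        exact Finset.sum_congr rfl fun i _ => by rw [map_smul, smul_eq_mul]
    _ = _ := by
        simp only [← h2, Finset.sum_mul, hb, coordBasis_apply]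
        exact Finset.sum_congr rfl fun k _ => Finset.sum_congr rfl fun b _ => by ring

theorem continuous_cometric (g : Metric n M) (α β : OneForm n M) :
    Continuous fun p => cometric g p (α p) (β p) := by
  refine (contMDiff_of_comp₀ (n := n) fun φ hφ => ?_).continuous
  have hG := isCoordMetric hφ g
  have : ContDiffOn ℝ ∞ (fun y => ∑ a, ∑ b,
      (comp₂ φ g.inner y)⁻¹ a b * comp₁ φ α a y * comp₁ φ β b y)
      (φ.extend (𝓡∂ (n + 1))).target :=
    ContDiffOn.sum fun a _ => ContDiffOn.sum fun b _ =>
      ((hG.smooth_inv a b).mul (contDiffOn_comp₁ hφ α a)).mul (contDiffOn_comp₁ hφ β b)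
  exact this.congr fun y hy => cometric_eq_sum hφ g hy _ _

theorem cometric_dAt (hφ : φ ∈ IsManifold.maximalAtlas (𝓡∂ (n + 1)) ∞ M) (g : Metric n M)
    (f : SmoothFun n M) (hy : y ∈ (φ.extend (𝓡∂ (n + 1))).target) :
    cometric g _ (dAt f ((φ.extend (𝓡∂ (n + 1))).symm y))
      (dAt f ((φ.extend (𝓡∂ (n + 1))).symm y)) =
      gradSq (comp₂ φ g.inner) (comp₀ φ f) y := by
  rw [cometric_eq_sum hφ g hy, gradSq]
  simp only [pd_comp₀ hφ f hy]

/-! ### The differential as a one-form -/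

/-- The differential of a smooth function. -/
def dForm (f : SmoothFun n M) : OneForm n M where
  toFun := dAt f
  contMDiff_toFun := by
    intro p
    rw [contMDiffAt_hom_bundle]
    refine ⟨contMDiffAt_id, ?_⟩
    have h := (f.contMDiff p).mfderiv_const (m := ∞) (by simp)
    refine h.congr_of_eventuallyEq (Eventually.of_forall fun q => ?_)
    ext v
    simp [inTangentCoordinates, ContinuousLinearMap.inCoordinates, dAt]
    rfl

@[simp]
theorem dForm_apply (f : SmoothFun n M) (p : M) : dForm f p = dAt f p := rfl

end

/-! ### The global bottom slot, and the Einstein equation of a parallel tractor -/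

section

variable {n : ℕ} {M : Type*} [TopologicalSpace M] [ChartedSpace (EuclideanHalfSpace (n + 1)) M]
  [IsManifold (𝓡∂ (n + 1)) ∞ M]
  {φ : OpenPartialHomeomorph M (EuclideanHalfSpace (n + 1))} {y : Coord n}

theorem comp₂_interiorMetric (φ : OpenPartialHomeomorph M (EuclideanHalfSpace (n + 1)))
    (g : Metric n M) (σ : SmoothFun n M) :
    comp₂ φ (interiorMetric g σ) = fun z => ((comp₀ φ σ z) ^ 2)⁻¹ • comp₂ φ g.inner z := by
  ext z i j
  rfl

/-- In a chart, the tractor `(σ, dσ, ρ)` with `ρ = -(Δσ + J σ) / d` has vanishing middle slot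
derivative and unit length, up to the boundary, if `σ^{-2} g` is Einstein in the interior. -/
theorem hess_eq_zero_of_ricciEqOn (hn : 2 ≤ n) {g : Metric n M} {σ : SmoothFun n M}
    (h0 : ∀ p ∉ (𝓡∂ (n + 1)).boundary M, σ p ≠ 0)
    (hE : RicciEqOn (interiorMetric g σ) (-(n : ℝ)) ((𝓡∂ (n + 1)).boundary M)ᶜ)
    (hφ : φ ∈ IsManifold.maximalAtlas (𝓡∂ (n + 1)) ∞ M)
    (hy : y ∈ (φ.extend (𝓡∂ (n + 1))).target) :
    (∀ a b, hess (comp₂ φ g.inner) (comp₀ φ σ) a b y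
      + comp₂ φ g.inner y a b * coordRho (comp₂ φ g.inner) (comp₀ φ σ) y
      + schouten (comp₂ φ g.inner) y a b * comp₀ φ σ y = 0) ∧
    2 * coordRho (comp₂ φ g.inner) (comp₀ φ σ) y * comp₀ φ σ y
      + gradSq (comp₂ φ g.inner) (comp₀ φ σ) y = 1 := by
  have hG := isCoordMetric hφ g
  have hs := contDiffOn_comp₀ hφ σ
  have key : ∀ z ∈ (φ.extend (𝓡∂ (n + 1))).target,
      (φ.extend (𝓡∂ (n + 1))).symm z ∉ (𝓡∂ (n + 1)).boundary M → _ := fun z hz hzb =>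
    hG.hess_of_ricci_eq hn hs hz (h0 _ hzb) (by
      have := hE φ hφ z hz hzb
      simp only [comp₂_interiorMetric] at this
      exact this)
  constructor
  · intro a b
    refine eq_zero_of_eq_zero_on_interior (φ := φ) (F := fun y =>
      hess (comp₂ φ g.inner) (comp₀ φ σ) a b y
      + comp₂ φ g.inner y a b * coordRho (comp₂ φ g.inner) (comp₀ φ σ) y
      + schouten (comp₂ φ g.inner) y a b * comp₀ φ σ y) ?_ (fun z hz hzb => (key z hz hzb).1 a b) hy
    exact (((hG.smooth_hess hs a b).add ((hG.smooth a b).mul (hG.smooth_coordRho hs))).add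
      ((hG.smooth_schouten a b).mul hs)).continuousOn
  · rw [← sub_eq_zero]
    refine eq_zero_of_eq_zero_on_interior (φ := φ) (F := fun y =>
      2 * coordRho (comp₂ φ g.inner) (comp₀ φ σ) y * comp₀ φ σ y
      + gradSq (comp₂ φ g.inner) (comp₀ φ σ) y - 1) ?_
      (fun z hz hzb => sub_eq_zero.2 (key z hz hzb).2) hy
    exact ((((contDiffOn_const.mul (hG.smooth_coordRho hs)).mul hs).add
      (hG.smooth_gradSq hs)).sub contDiffOn_const).continuousOn

/-- If `σ^{-2} g` is Einstein in the interior, then `σ` is the scale of a unit parallel tractor: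
this gives its bottom slot in the scale `g`. -/
theorem exists_bottom_slot (hn : 2 ≤ n) {g : Metric n M} {σ : SmoothFun n M}
    (h0 : ∀ p ∉ (𝓡∂ (n + 1)).boundary M, σ p ≠ 0)
    (hE : RicciEqOn (interiorMetric g σ) (-(n : ℝ)) ((𝓡∂ (n + 1)).boundary M)ᶜ) :
    ∃ ρ : SmoothFun n M, (∀ p, 2 * ρ p * σ p + cometric g p (dAt σ p) (dAt σ p) = 1) ∧
      InAllCharts (Set.univ : Set M) fun φ y =>
        (∀ a b, hess (comp₂ φ g.inner) (comp₀ φ σ) a b y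
          + comp₂ φ g.inner y a b * comp₀ φ ρ y
          + schouten (comp₂ φ g.inner) y a b * comp₀ φ σ y = 0) ∧
        (∀ a, pd a (comp₀ φ ρ) y - ∑ b, ∑ e, schouten (comp₂ φ g.inner) y a b
          * (comp₂ φ g.inner y)⁻¹ b e * pd e (comp₀ φ σ) y = 0) := by
  -- One candidate for `ρ` per chart; they are glued below by reading each point in its preferred
  -- chart.
  let F : OpenPartialHomeomorph M (EuclideanHalfSpace (n + 1)) → M → ℝ := fun φ p =>
    coordRho (comp₂ φ g.inner) (comp₀ φ σ) (φ.extend (𝓡∂ (n + 1)) p)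
  have hcont : ∀ φ ∈ IsManifold.maximalAtlas (𝓡∂ (n + 1)) ∞ M, ContinuousOn (F φ) φ.source :=
    fun φ hφ => continuousOn_comp_extend
      ((isCoordMetric hφ g).smooth_coordRho (contDiffOn_comp₀ hφ σ)).continuousOn
  have hlen : ∀ φ ∈ IsManifold.maximalAtlas (𝓡∂ (n + 1)) ∞ M, ∀ p ∈ φ.source,
      2 * F φ p * σ p + cometric g p (dAt σ p) (dAt σ p) = 1 := by
    intro φ hφ p hp
    have h1 := (hess_eq_zero_of_ricciEqOn hn h0 hE hφ (extend_mem_target hp)).2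
    rw [← cometric_dAt hφ g σ (extend_mem_target hp), comp₀, φ.extend_left_inv hp] at h1
    exact h1
  -- Where `σ ≠ 0` both candidates solve the same equation `2ρσ + |dσ|² = 1`; density of the
  -- interior does the rest. This replaces the coordinate invariance of the Laplacian and the scalar
  -- curvature.
  have hagree : ∀ φ ∈ IsManifold.maximalAtlas (𝓡∂ (n + 1)) ∞ M,
      ∀ ψ ∈ IsManifold.maximalAtlas (𝓡∂ (n + 1)) ∞ M, ∀ p ∈ φ.source ∩ ψ.source,
      F φ p = F ψ p := by
    intro φ hφ ψ hψ p hp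
    rw [← sub_eq_zero]
    refine eq_zero_of_eq_zero_on_compl_boundary (n := n) (F := fun p => F φ p - F ψ p)
      (φ.open_source.inter ψ.open_source)
      (((hcont φ hφ).mono Set.inter_subset_left).sub ((hcont ψ hψ).mono Set.inter_subset_right))
      (fun q hq hqb => ?_) hp
    have h1 := hlen φ hφ q hq.1
    have h2 := hlen ψ hψ q hq.2
    apply mul_right_cancel₀ (h0 q hqb)
    linear_combination (h1 - h2) / 2
  have hcomp : ∀ φ ∈ IsManifold.maximalAtlas (𝓡∂ (n + 1)) ∞ M,
      ∀ y ∈ (φ.extend (𝓡∂ (n + 1))).target,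
      comp₀ φ (fun p => F (chartAt (EuclideanHalfSpace (n + 1)) p) p) y
        = coordRho (comp₂ φ g.inner) (comp₀ φ σ) y := by
    intro φ hφ y hy
    have := hagree _ (IsManifold.chart_mem_maximalAtlas ((φ.extend (𝓡∂ (n + 1))).symm y)) φ hφ
      ((φ.extend (𝓡∂ (n + 1))).symm y) ⟨mem_chart_source _ _, symm_mem_source hy⟩
    refine this.trans ?_
    simp only [F]
    rw [(φ.extend (𝓡∂ (n + 1))).right_inv hy]
  have hsmooth : ContMDiff (𝓡∂ (n + 1)) 𝓘(ℝ, ℝ) ∞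
      (fun p : M => F (chartAt (EuclideanHalfSpace (n + 1)) p) p) :=
    contMDiff_of_comp₀ fun φ hφ =>
      ((isCoordMetric hφ g).smooth_coordRho (contDiffOn_comp₀ hφ σ)).congr (hcomp φ hφ)
  refine ⟨⟨_, hsmooth⟩, fun p => hlen _ (IsManifold.chart_mem_maximalAtlas p) p
    (mem_chart_source _ p), fun φ hφ y hy _ => ?_⟩
  have hG := isCoordMetric hφ g
  have hs := contDiffOn_comp₀ hφ σ
  have hc := hcomp φ hφ
  set ρ : SmoothFun n M := ⟨_, hsmooth⟩
  have hρ := contDiffOn_comp₀ hφ ρ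
  replace hc : ∀ y ∈ (φ.extend (𝓡∂ (n + 1))).target, comp₀ φ ρ y
    = coordRho (comp₂ φ g.inner) (comp₀ φ σ) y := hc
  have hmid : ∀ y ∈ (φ.extend (𝓡∂ (n + 1))).target, ∀ a b,
      hess (comp₂ φ g.inner) (comp₀ φ σ) a b y + comp₂ φ g.inner y a b * comp₀ φ ρ y
        + schouten (comp₂ φ g.inner) y a b * comp₀ φ σ y = 0 := by
    intro y hy a b
    rw [hc y hy]
    exact (hess_eq_zero_of_ricciEqOn hn h0 hE hφ hy).1 a b
  refine ⟨hmid y hy, fun a => ?_⟩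
  refine eq_zero_of_eq_zero_on_interior (φ := φ) (F := fun y => pd a (comp₀ φ ρ) y
    - ∑ b, ∑ e, schouten (comp₂ φ g.inner) y a b
      * (comp₂ φ g.inner y)⁻¹ b e * pd e (comp₀ φ σ) y) ?_ (fun z hz hzb => ?_) hy
  · refine ((contDiffOn_pd hG.isRelOpen hρ a).sub (ContDiffOn.sum fun b _ =>
      ContDiffOn.sum fun e _ => ?_)).continuousOn
    exact ((hG.smooth_schouten a b).mul (hG.smooth_inv b e)).mul
      (contDiffOn_pd hG.isRelOpen hs e)
  · refine hG.pd_rho hs hρ hz (h0 _ hzb) (hmid z hz) (fun w hw => ?_) a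
    rw [hc w hw]
    exact (hess_eq_zero_of_ricciEqOn hn h0 hE hφ hw).2

/-- Near a point where `σ ≠ 0`, the metric `σ^{-2} g` determined by a parallel tractor is Einstein,
with Einstein constant given by the length of the tractor. -/
theorem ricci_eq_of_isParallel (hn : 2 ≤ n) {c : ConformalStructure n M} {I : Tractor c}
    (hI : I.IsParallel) (hφ : φ ∈ IsManifold.maximalAtlas (𝓡∂ (n + 1)) ∞ M)
    (hy : y ∈ (φ.extend (𝓡∂ (n + 1))).target) (g : Scale c)
    (h0 : I.top g ((φ.extend (𝓡∂ (n + 1))).symm y) ≠ 0) :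
    ricci (comp₂ φ I.scale.metric) y =
      (-(n : ℝ) * I.normSq ((φ.extend (𝓡∂ (n + 1))).symm y)) • comp₂ φ I.scale.metric y := by
  have hG := isCoordMetric hφ g.1
  have hs := contDiffOn_comp₀ hφ (I.top g)
  have hm : I.scale.metric = interiorMetric g.1 (I.top g) :=
    funext fun p => I.scale.metric_eq g p
  have hmid : ∀ z ∈ (φ.extend (𝓡∂ (n + 1))).target, ∀ a,
      comp₁ φ (I.mid g) a z = pd a (comp₀ φ (I.top g)) z := fun z hz a =>
    (sub_eq_zero.1 ((hI g φ hφ z hz trivial).1 a)).symm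
  rw [hm, comp₂_interiorMetric, I.normSq_eq g, cometric_eq_sum hφ g.1 hy]
  have h2 : ∀ a b, hess (comp₂ φ g.1.inner) (comp₀ φ (I.top g)) a b y
      + comp₂ φ g.1.inner y a b * comp₀ φ (I.bot g) y
      + schouten (comp₂ φ g.1.inner) y a b * comp₀ φ (I.top g) y = 0 := by
    intro a b
    have := (hI g φ hφ y hy trivial).2.1 a b
    -- The top slot equation holds on the whole chart, so it may be differentiated: the covariant
    -- derivative of `μ` becomes the Hessian of `σ`.
    rw [pd_congr hG.isRelOpen (fun z hz => hmid z hz b) a hy] at this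
    simp only [hmid y hy] at this
    exact this
  have := hG.ricci_eq_of_hess hn hs hy h0 h2
  rw [this]
  have h3 : ∀ a, I.mid g ((φ.extend (𝓡∂ (n + 1))).symm y) (coordVec φ a y)
    = pd a (comp₀ φ (I.top g)) y := hmid y hy
  simp only [h3]
  rfl

/-- The middle slot of a parallel tractor is the differential of its top slot. -/
theorem mid_eq_dAt_of_isParallel {c : ConformalStructure n M} {I : Tractor c}
    (hI : I.IsParallel) (g : Scale c) (p : M) : I.mid g p = dAt (I.top g) p := by
  set φ := chartAt (EuclideanHalfSpace (n + 1)) p with hφdef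
  have hφ : φ ∈ IsManifold.maximalAtlas (𝓡∂ (n + 1)) ∞ M := IsManifold.chart_mem_maximalAtlas p
  have hy := extend_mem_target (φ := φ) (mem_chart_source _ p)
  have key : I.mid g ((φ.extend (𝓡∂ (n + 1))).symm (φ.extend (𝓡∂ (n + 1)) p))
      = dAt (I.top g) ((φ.extend (𝓡∂ (n + 1))).symm (φ.extend (𝓡∂ (n + 1)) p)) := by
    apply ContinuousLinearMap.coe_injective
    refine (coordBasis hφ hy).ext fun i => ?_
    rw [coordBasis_apply]
    have := (hI g φ hφ _ hy trivial).1 i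
    rw [pd_comp₀ hφ _ hy] at this
    exact (sub_eq_zero.1 this).symm
  rwa [φ.extend_left_inv (mem_chart_source _ p)] at key

end

section

variable {n : ℕ} {M : Type*} [TopologicalSpace M] [ChartedSpace (EuclideanHalfSpace (n + 1)) M]
  [IsManifold (𝓡∂ (n + 1)) ∞ M]

/-! ### Rescalings and densities -/

/-- Both factors are tested on one nonzero vector. Uniqueness makes a density well defined by its
representative in a single scale. -/
theorem IsRescaling.unique {g g' : Metric n M} {u v : SmoothFun n M} (hu : IsRescaling g g' u)
    (hv : IsRescaling g g' v) (p : M) : u p = v p := by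
  let e : TangentSpace (𝓡∂ (n + 1)) p := (EuclideanSpace.single 0 (1 : ℝ) : Coord n)
  have he : e ≠ 0 := by
    intro h
    have : (EuclideanSpace.single 0 (1 : ℝ) : Coord n) = 0 := h
    simp at this
  have h := (hu p e e).symm.trans (hv p e e)
  have := Real.exp_injective (mul_right_cancel₀ (g.pos p e he).ne' h)
  linarith

theorem IsRescaling.trans {g g' g'' : Metric n M} {u v : SmoothFun n M} (hu : IsRescaling g g' u)
    (hv : IsRescaling g' g'' v) : IsRescaling g g'' (u + v) := fun p e f => by
  have h : (u + v : SmoothFun n M) p = u p + v p := rfl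
  rw [hv p e f, hu p e f, h, ← mul_assoc, ← Real.exp_add]
  ring_nf

/-- The function `exp (w u)`. -/
def expFun (w : ℝ) (u : SmoothFun n M) : SmoothFun n M :=
  ⟨fun p => Real.exp (w * u p), (Real.contDiff_exp.contMDiff (n := ∞)).comp
    ((contDiff_const.mul contDiff_id : ContDiff ℝ ∞ fun t : ℝ => w * t).contMDiff.comp
      u.contMDiff)⟩

/-- The density of weight `w` that is represented by `f` in the scale `g`. -/
def Density.ofScale {c : ConformalStructure n M} (w : ℝ) (g : Scale c) (f : SmoothFun n M) :
    Density c w where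
  inScale g' := expFun w (Scale.exists_rescaling g g').choose * f
  transform g₁ g₂ u h p := by
    have h₁ := (Scale.exists_rescaling g g₁).choose_spec
    have h₂ := (Scale.exists_rescaling g g₂).choose_spec
    have e := h₂.unique (h₁.trans h) p
    have e' : ((Scale.exists_rescaling g g₁).choose + u : SmoothFun n M) p
      = (Scale.exists_rescaling g g₁).choose p + u p := rfl
    change Real.exp (w * _) * f p = _ * (Real.exp (w * _) * f p)
    rw [e, e', ← mul_assoc, ← Real.exp_add]
    ring_nf

theorem Density.ofScale_apply {c : ConformalStructure n M} (w : ℝ) {g g' : Scale c}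
    (f : SmoothFun n M) {u : SmoothFun n M} (hu : IsRescaling g.1 g'.1 u) (p : M) :
    (Density.ofScale w g f).inScale g' p = Real.exp (w * u p) * f p := by
  rw [hu.unique (Scale.exists_rescaling g g').choose_spec p]
  rfl

theorem IsRescaling.refl (g : Metric n M) : IsRescaling g g 0 := fun p v w => by simp

theorem Density.ofScale_self {c : ConformalStructure n M} (w : ℝ) (g : Scale c)
    (f : SmoothFun n M) (p : M) : (Density.ofScale w g f).inScale g p = f p := by
  rw [Density.ofScale_apply w f (IsRescaling.refl g.1)]
  simp

theorem dAt_mul (f h : SmoothFun n M) (p : M) :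
    dAt (f * h) p = f p • dAt h p + h p • dAt f p := by
  have hf : HasMFDerivAt (𝓡∂ (n + 1)) 𝓘(ℝ, ℝ) f p (dAt f p) :=
    (f.contMDiff.mdifferentiableAt (by simp)).hasMFDerivAt
  have hh : HasMFDerivAt (𝓡∂ (n + 1)) 𝓘(ℝ, ℝ) h p (dAt h p) :=
    (h.contMDiff.mdifferentiableAt (by simp)).hasMFDerivAt
  exact (hf.mul hh).mfderiv

theorem dAt_expFun_one (u : SmoothFun n M) (p : M) :
    dAt (expFun 1 u) p = Real.exp (u p) • dAt u p := by
  have hu : HasMFDerivAt (𝓡∂ (n + 1)) 𝓘(ℝ, ℝ) u p (dAt u p) :=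
    (u.contMDiff.mdifferentiableAt (by simp)).hasMFDerivAt
  have he : HasMFDerivAt 𝓘(ℝ, ℝ) 𝓘(ℝ, ℝ) Real.exp (u p) _ :=
    (Real.hasDerivAt_exp (u p)).hasFDerivAt.hasMFDerivAt
  have h := (he.comp p hu).mfderiv
  have e : (expFun 1 u : M → ℝ) = Real.exp ∘ u := by
    funext q
    simp [expFun]
  rw [dAt, e, h]
  ext v
  change dAt u p v * Real.exp (u p) = Real.exp (u p) * dAt u p v
  ring

/-- The product rule for `e^u σ` is the transformation law of the middle slot in the case `μ = dσ`.
-/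
theorem dAt_of_rescaling {σ σ' u : SmoothFun n M} (h : ∀ p, σ' p = Real.exp (u p) * σ p) (p : M) :
    dAt σ' p = Real.exp (u p) • (dAt σ p + σ p • dAt u p) := by
  have e : σ' = expFun 1 u * σ := by
    ext q
    rw [h]
    change _ = Real.exp (1 * u q) * σ q
    rw [one_mul]
  have e1 : expFun 1 u p = Real.exp (u p) := congrArg Real.exp (one_mul _)
  rw [e, dAt_mul, dAt_expFun_one, e1, smul_add, smul_smul, smul_smul, mul_comm]

theorem cometric_add_smul (g : Metric n M) (p : M) (a b : ℝ)
    (α β : TangentSpace (𝓡∂ (n + 1)) p →L[ℝ] ℝ) :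
    cometric g p (a • (α + b • β)) (a • (α + b • β)) = a ^ 2 *
      (cometric g p α α + 2 * b * cometric g p β α + b ^ 2 * cometric g p β β) := by
  have hc := cometric_comm g p α β
  have expand : cometric g p (a • (α + b • β)) (a • (α + b • β)) = a ^ 2 *
      (cometric g p α α + b * cometric g p α β
        + b * cometric g p β α + b ^ 2 * cometric g p β β) := by
    simp only [cometric, ContinuousLinearMap.toLinearMap_smul, ContinuousLinearMap.toLinearMap_add,
      map_smul, map_add, smul_apply, add_apply, smul_eq_mul]
    ring
  rw [expand, hc]
  ring

/-- The transformation law of the bottom slot follows from the length normalisation. -/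
theorem bottom_slot_transform {g g' : Metric n M} {σ σ' ρ ρ' u : SmoothFun n M}
    (hg : IsRescaling g g' u) (hσ : ∀ p, σ' p = Real.exp (u p) * σ p)
    (h0 : ∀ p ∉ (𝓡∂ (n + 1)).boundary M, σ p ≠ 0)
    (h : ∀ p, 2 * ρ p * σ p + cometric g p (dAt σ p) (dAt σ p) = 1)
    (h' : ∀ p, 2 * ρ' p * σ' p + cometric g' p (dAt σ' p) (dAt σ' p) = 1) (p : M) :
    ρ' p = Real.exp (-(u p)) * (ρ p - cometric g p (dAt u p) (dAt σ p)
      - (1 / 2) * cometric g p (dAt u p) (dAt u p) * σ p) := by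
  have hc : Continuous fun p => ρ' p - Real.exp (-(u p)) * (ρ p - cometric g p (dAt u p) (dAt σ p)
      - (1 / 2) * cometric g p (dAt u p) (dAt u p) * σ p) := by
    have h1 := continuous_cometric g (dForm u) (dForm σ)
    have h2 := continuous_cometric g (dForm u) (dForm u)
    have h3 := u.contMDiff.continuous
    have h4 := σ.contMDiff.continuous
    have h5 := ρ.contMDiff.continuous
    have h6 := ρ'.contMDiff.continuous
    simp only [dForm_apply] at h1 h2
    fun_prop
  rw [← sub_eq_zero]
  refine eq_zero_of_eq_zero_on_compl_boundary (n := n) isOpen_univ hc.continuousOn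
    (fun q _ hq => ?_) (Set.mem_univ p)
  have e1 := h q
  have e2 := h' q
  rw [cometric_rescaling hg, dAt_of_rescaling hσ, cometric_add_smul, hσ q] at e2
  have x1 : Real.exp (-(2 * u q)) * Real.exp (u q) ^ 2 = 1 := by
    rw [← Real.exp_nat_mul, ← Real.exp_add]; simp
  have x2 : Real.exp (-(u q)) * Real.exp (u q) = 1 := by
    rw [← Real.exp_add]; simp
  -- In the interior the two length equations can be compared and divided by `σ' = e^u σ`; the
  -- expansion of `|dσ'|²` yields the terms in `du`.
  have hne : Real.exp (u q) * σ q ≠ 0 := mul_ne_zero (Real.exp_pos _).ne' (h0 q hq)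
  apply mul_left_cancel₀ hne
  linear_combination (e2 - e1) / 2 - (1 / 2) * (cometric g q (dAt σ q) (dAt σ q)
      + 2 * σ q * cometric g q (dAt u q) (dAt σ q)
      + σ q ^ 2 * cometric g q (dAt u q) (dAt u q)) * x1
    - σ q * (ρ q - cometric g q (dAt u q) (dAt σ q)
      - (1 / 2) * cometric g q (dAt u q) (dAt u q) * σ q) * x2

/-! ### The sign of the scale -/

theorem pos_of_notMem_boundary (p : M) {q : M}
    (hq : q ∈ (chartAt (EuclideanHalfSpace (n + 1)) p).source)
    (hqb : q ∉ (𝓡∂ (n + 1)).boundary M) :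
    0 < ((chartAt (EuclideanHalfSpace (n + 1)) p).extend (𝓡∂ (n + 1)) q) 0 := by
  rw [← Set.mem_compl_iff, ModelWithCorners.compl_boundary] at hqb
  have h := (ModelWithCorners.isInteriorPoint_iff_of_mem_atlas (n := ∞) (by simp)
    (chart_mem_atlas _ p) hq).1 hqb
  have h' := OpenPartialHomeomorph.interior_extend_target_subset_interior_range _ h
  rw [interior_range_modelWithCornersEuclideanHalfSpace] at h'
  exact h'

/-- The points of a small coordinate ball with positive zeroth coordinate form a convex set on which
`σ` has no zero, so the intermediate value theorem excludes both signs. The remaining points of the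
ball are boundary points, where `σ = 0`. -/
theorem exists_local_sign {σ : SmoothFun n M}
    (h0 : ∀ p, σ p = 0 ↔ p ∈ (𝓡∂ (n + 1)).boundary M) (p : M) :
    ∃ O : Set M, IsOpen O ∧ p ∈ O ∧ ((∀ q ∈ O, 0 ≤ σ q) ∨ (∀ q ∈ O, σ q ≤ 0)) := by
  set φ := chartAt (EuclideanHalfSpace (n + 1)) p with hφdef
  have hφ : φ ∈ IsManifold.maximalAtlas (𝓡∂ (n + 1)) ∞ M := IsManifold.chart_mem_maximalAtlas p
  have hp : p ∈ φ.source := mem_chart_source _ p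
  set y := φ.extend (𝓡∂ (n + 1)) p with hydef
  obtain ⟨r, hr, hsub⟩ := Metric.mem_nhdsWithin_iff.1
    ((isRelOpen_target φ).mem_nhdsWithin y (extend_mem_target hp))
  set B := Metric.ball y r ∩ {z : Coord n | 0 < z 0} with hB
  have hBt : B ⊆ (φ.extend (𝓡∂ (n + 1))).target := by
    rintro z ⟨hz, hz0⟩
    refine hsub ⟨hz, ?_⟩
    rw [range_modelWithCornersEuclideanHalfSpace]
    exact (show 0 < z 0 from hz0).le
  have hconv : Convex ℝ B := by
    refine (convex_ball y r).inter ?_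
    exact convex_halfSpace_gt ⟨fun _ _ => rfl, fun _ _ => rfl⟩ 0
  have hcont : ContinuousOn (comp₀ φ σ) B :=
    (contDiffOn_comp₀ hφ σ).continuousOn.mono hBt
  have hne : ∀ z ∈ B, comp₀ φ σ z ≠ 0 := fun z hz h =>
    isInteriorPoint_of_chartAt p (hBt hz) hz.2 ((h0 _).1 h)
  have hO : IsOpen (φ.source ∩ φ.extend (𝓡∂ (n + 1)) ⁻¹' Metric.ball y r) :=
    φ.isOpen_extend_preimage Metric.isOpen_ball
  have hmemB : ∀ q ∈ φ.source ∩ φ.extend (𝓡∂ (n + 1)) ⁻¹' Metric.ball y r,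
      q ∉ (𝓡∂ (n + 1)).boundary M → φ.extend (𝓡∂ (n + 1)) q ∈ B := fun q hq hqb =>
    ⟨hq.2, pos_of_notMem_boundary p hq.1 hqb⟩
  have hval : ∀ q ∈ φ.source, comp₀ φ σ (φ.extend (𝓡∂ (n + 1)) q) = σ q := fun q hq => by
    rw [comp₀, φ.extend_left_inv hq]
  refine ⟨_, hO, ⟨hp, Metric.mem_ball_self hr⟩, ?_⟩
  by_contra hcon
  push Not at hcon
  obtain ⟨⟨q₁, hq₁, h1⟩, ⟨q₂, hq₂, h2⟩⟩ := hcon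
  have hb₁ := hmemB q₁ hq₁ fun h => h1.ne ((h0 _).2 h)
  have hb₂ := hmemB q₂ hq₂ fun h => h2.ne' ((h0 _).2 h)
  obtain ⟨z, hz, hz0⟩ := hconv.isPreconnected.intermediate_value hb₁ hb₂ hcont
    (show (0 : ℝ) ∈ Set.Icc _ _ by
      rw [hval _ hq₁.1, hval _ hq₂.1]
      exact ⟨h1.le, h2.le⟩)
  exact hne z hz hz0

/-- A smooth function whose zero set is the boundary has a locally constant sign. -/
theorem exists_sign {σ : SmoothFun n M} (h0 : ∀ p, σ p = 0 ↔ p ∈ (𝓡∂ (n + 1)).boundary M) :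
    ∃ s : SmoothFun n M, (∀ p, s p ^ 2 = 1) ∧ ∀ p, 0 ≤ s p * σ p := by
  classical
  let s : M → ℝ := fun p => if ∀ᶠ q in 𝓝 p, 0 ≤ σ q then 1 else -1
  have hpos : ∀ O : Set M, IsOpen O → (∀ q ∈ O, 0 ≤ σ q) → ∀ q ∈ O, s q = 1 := by
    intro O hO h q hq
    exact if_pos (eventually_of_mem (hO.mem_nhds hq) h)
  have hneg : ∀ O : Set M, IsOpen O → (∀ q ∈ O, σ q ≤ 0) → ∀ q ∈ O, s q = -1 := by
    intro O hO h q hq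
    refine if_neg fun h' => ?_
    -- If `σ` had both weak signs near `q`, it would vanish there, and a whole neighbourhood would
    -- lie in the boundary, against density of the interior.
    have h3 : {q | σ q = 0} ∈ 𝓝 q := by
      filter_upwards [h', hO.mem_nhds hq] with z hz hzO
      exact le_antisymm (h z hzO) hz
    obtain ⟨z, hz, hz'⟩ := mem_closure_iff_nhds.1 (dense_compl_boundary n M q) _ h3
    exact hz' ((h0 z).1 hz)
  have hsm : ContMDiff (𝓡∂ (n + 1)) 𝓘(ℝ, ℝ) ∞ s := by
    intro p
    obtain ⟨O, hO, hp, h | h⟩ := exists_local_sign h0 p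
    · exact contMDiffAt_const.congr_of_eventuallyEq
        (eventually_of_mem (hO.mem_nhds hp) (hpos O hO h))
    · exact contMDiffAt_const.congr_of_eventuallyEq
        (eventually_of_mem (hO.mem_nhds hp) (hneg O hO h))
  refine ⟨⟨s, hsm⟩, fun p => ?_, fun p => ?_⟩
  · change s p ^ 2 = 1
    simp only [s]
    split_ifs <;> norm_num
  · change 0 ≤ s p * σ p
    obtain ⟨O, hO, hp, h | h⟩ := exists_local_sign h0 p
    · rw [hpos O hO h p hp, one_mul]; exact h p hp
    · rw [hneg O hO h p hp]; linarith [h p hp]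

end

section

variable {n : ℕ} {M : Type*} [TopologicalSpace M] [ChartedSpace (EuclideanHalfSpace (n + 1)) M]
  [IsManifold (𝓡∂ (n + 1)) ∞ M]

/-! ### Poincaré–Einstein metrics and almost Einstein structures -/

theorem Tractor.mem_singularSet_iff {c : ConformalStructure n M} (I : Tractor c) (g : Scale c)
    (p : M) : p ∈ I.singularSet ↔ I.top g p = 0 := by
  refine ⟨fun h => h g, fun h g' => ?_⟩
  obtain ⟨u, hu⟩ := Scale.exists_rescaling g g'
  change I.top g' p = 0
  rw [I.transform_top g g' u hu, h, mul_zero]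

theorem Tractor.continuous_normSq {c : ConformalStructure n M} (I : Tractor c) :
    Continuous I.normSq := by
  have h1 := continuous_cometric (someScale c).1 (I.mid (someScale c)) (I.mid (someScale c))
  have h2 := (I.bot (someScale c)).contMDiff.continuous
  have h3 := (I.top (someScale c)).contMDiff.continuous
  exact ((continuous_const.mul h2).mul h3).add h1

theorem Tractor.isAlmostEinstein_of_normSq {c : ConformalStructure n M} {I : Tractor c}
    (hI : I.IsParallel) (h : ∀ p, I.normSq p = 1) : I.IsAlmostEinstein := by
  refine ⟨hI, fun p => ⟨p, mem_connectedComponent, fun h0 => ?_⟩⟩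
  have h1 := h p
  rw [I.normSq_eq (someScale c), (h0 _).1, (h0 _).2.1] at h1
  simp [cometric] at h1

/-- The equation `2ρx + |dx|² = 1` holds up to the boundary with `ρ` smooth, and there its first
term drops out. -/
theorem cometric_dAt_eq_one_of_isPoincareEinstein (hn : 2 ≤ n) {g : Metric n M}
    {x : SmoothFun n M} (h : IsPoincareEinstein g x) {p : M}
    (hp : p ∈ (𝓡∂ (n + 1)).boundary M) : cometric g p (dAt x p) (dAt x p) = 1 := by
  obtain ⟨ρ, hρ, -⟩ := exists_bottom_slot hn
    (fun p hp h0 => hp ((h.defining.zero_iff p).1 h0)) h.einstein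
  have := hρ p
  rwa [(h.defining.zero_iff p).2 hp, mul_zero, zero_add] at this

theorem det_comp₂_interiorMetric_ne_zero
    {φ : OpenPartialHomeomorph M (EuclideanHalfSpace (n + 1))} {y : Coord n}
    (hφ : φ ∈ IsManifold.maximalAtlas (𝓡∂ (n + 1)) ∞ M) (g : Metric n M) {σ : SmoothFun n M}
    (hy : y ∈ (φ.extend (𝓡∂ (n + 1))).target)
    (h0 : σ ((φ.extend (𝓡∂ (n + 1))).symm y) ≠ 0) :
    (comp₂ φ (interiorMetric g σ) y).det ≠ 0 := by
  have h0' : comp₀ φ σ y ≠ 0 := h0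
  rw [comp₂_interiorMetric]
  simpa [Matrix.det_smul, h0'] using det_comp₂_ne_zero hφ g hy

/-- The trace of the Einstein equation gives scalar curvature `-n(n+1)`. -/
theorem scalNegOn_interiorMetric (hn : 2 ≤ n) {g : Metric n M} {σ : SmoothFun n M} {U : Set M}
    (h0 : ∀ p ∈ U, σ p ≠ 0) (hE : RicciEqOn (interiorMetric g σ) (-(n : ℝ)) U) :
    ScalNegOn (interiorMetric g σ) U := by
  intro φ hφ y hy hyU
  have := scal_of_ricci_eq (fun i j => by
      simp only [comp₂_interiorMetric, Matrix.smul_apply]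
      rw [(isCoordMetric hφ g).symm y hy i j])
    (det_comp₂_interiorMetric_ne_zero hφ g hy (h0 _ hyU)) (hE φ hφ y hy hyU)
  rw [this]
  have : (0 : ℝ) < n := by
    have : 0 < n := by omega
    exact_mod_cast this
  nlinarith

/-- A Poincaré–Einstein structure gives an almost Einstein structure of unit length. -/
theorem exists_tractor_of_isPoincareEinstein (hn : 2 ≤ n) {g : Metric n M} {x : SmoothFun n M}
    (h : IsPoincareEinstein g x) :
    ∃ I : Tractor (conformalClass g), I.IsParallel ∧ (∀ p, I.normSq p = 1) ∧
      ∀ g' p, I.top g' p =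
        x p * (Density.ofScale 1 (⟨g, rfl⟩ : Scale (conformalClass g)) 1).inScale g' p := by
  set c := conformalClass g
  let g₀ : Scale c := ⟨g, rfl⟩
  set τ : Density c 1 := Density.ofScale 1 g₀ 1 with hτ
  let σ : Scale c → SmoothFun n M := fun g' => x * τ.inScale g'
  have hσ_apply : ∀ g' p, σ g' p = x p * τ.inScale g' p := fun g' p => rfl
  have hσ : ∀ (g₁ g₂ : Scale c) (u : SmoothFun n M), IsRescaling g₁.1 g₂.1 u →
      ∀ p, σ g₂ p = Real.exp (u p) * σ g₁ p := by
    intro g₁ g₂ u hu p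
    rw [hσ_apply, hσ_apply, τ.transform g₁ g₂ u hu, one_mul]
    ring
  have hτ0 : ∀ g' p, τ.inScale g' p ≠ 0 := by
    intro g' p
    obtain ⟨u, hu⟩ := Scale.exists_rescaling g₀ g'
    rw [hτ, Density.ofScale_apply 1 1 hu]
    exact mul_ne_zero (Real.exp_pos _).ne' one_ne_zero
  have h0 : ∀ g', ∀ p ∉ (𝓡∂ (n + 1)).boundary M, σ g' p ≠ 0 := fun g' p hp =>
    mul_ne_zero (fun h0 => hp ((h.defining.zero_iff p).1 h0)) (hτ0 g' p)
  -- The metric `σ⁻² 𝐠` is the same in all scales, so the Einstein hypothesis is available in each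
  -- of them.
  have hmetric : ∀ g' : Scale c, interiorMetric g'.1 (σ g') = interiorMetric g x := by
    intro g'
    have e : τ.metric = g.inner := by
      funext p
      rw [τ.metric_eq g₀, hτ, Density.ofScale_self]
      change ((1 : ℝ) ^ 2)⁻¹ • g.inner p = g.inner p
      simp
    funext p
    have e1 := congrFun e p
    rw [τ.metric_eq g' p] at e1
    rw [interiorMetric, interiorMetric, ← e1, smul_smul, hσ_apply, mul_pow, mul_inv]
  have hE : ∀ g' : Scale c,
      RicciEqOn (interiorMetric g'.1 (σ g')) (-(n : ℝ)) ((𝓡∂ (n + 1)).boundary M)ᶜ := fun g' => by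
    rw [hmetric]
    exact h.einstein
  -- The bottom slots are chosen in each scale independently; `bottom_slot_transform` makes them
  -- compatible because all of them satisfy the length equation.
  choose ρ hlen hpar using fun g' => exists_bottom_slot hn (h0 g') (hE g')
  let I : Tractor c :=
    { top := σ
      mid := fun g' => dForm (σ g')
      bot := ρ
      transform_top := hσ
      transform_mid := fun g₁ g₂ u hu p => dAt_of_rescaling (hσ g₁ g₂ u hu) p
      transform_bot := fun g₁ g₂ u hu p =>
        bottom_slot_transform hu (hσ g₁ g₂ u hu) (h0 g₁) (hlen g₁) (hlen g₂) p }
  refine ⟨I, fun g' φ hφ y hy _ => ?_, fun p => hlen (someScale c) p, hσ_apply⟩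
  have hmid : ∀ z ∈ (φ.extend (𝓡∂ (n + 1))).target, ∀ a,
      comp₁ φ (I.mid g') a z = pd a (comp₀ φ (σ g')) z := fun z hz a =>
    (pd_comp₀ hφ (σ g') hz a).symm
  obtain ⟨h1, h2⟩ := hpar g' φ hφ y hy trivial
  refine ⟨fun a => ?_, fun a b => ?_, fun a => ?_⟩
  · rw [hmid y hy, sub_eq_zero]
  · rw [pd_congr (isRelOpen_target φ) (fun z hz => hmid z hz b) a hy]
    simp only [hmid y hy]
    exact h1 a b
  · simp only [hmid y hy]
    exact h2 a

theorem ricciEqOn_of_normSq (hn : 2 ≤ n) {c : ConformalStructure n M} {I : Tractor c}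
    (hI : I.IsParallel) (hS : I.singularSet = (𝓡∂ (n + 1)).boundary M)
    (h : ∀ p, I.normSq p = 1) :
    RicciEqOn I.scale.metric (-(n : ℝ)) ((𝓡∂ (n + 1)).boundary M)ᶜ := by
  intro φ hφ y hy hyb
  have := ricci_eq_of_isParallel hn hI hφ hy (someScale c)
    (fun h0 => hyb (hS ▸ (I.mem_singularSet_iff _ _).2 h0))
  rwa [h, mul_one] at this

/-- At each interior point the Einstein constants `-n |I|²` and `-n` of the same nonzero matrix must
agree; continuity reaches the boundary. Constancy of `|I|²` plays no role. -/
theorem normSq_of_ricciEqOn (hn : 2 ≤ n) {c : ConformalStructure n M} {I : Tractor c}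
    (hI : I.IsParallel) (hS : I.singularSet = (𝓡∂ (n + 1)).boundary M)
    (h : RicciEqOn I.scale.metric (-(n : ℝ)) ((𝓡∂ (n + 1)).boundary M)ᶜ) (p : M) :
    I.normSq p = 1 := by
  rw [← sub_eq_zero]
  refine eq_zero_of_eq_zero_on_compl_boundary (n := n) (F := fun p => I.normSq p - 1) isOpen_univ
    (I.continuous_normSq.sub continuous_const).continuousOn (fun q _ hqb => ?_) (Set.mem_univ p)
  set φ := chartAt (EuclideanHalfSpace (n + 1)) q with hφdef
  have hφ : φ ∈ IsManifold.maximalAtlas (𝓡∂ (n + 1)) ∞ M := IsManifold.chart_mem_maximalAtlas q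
  have hq : q ∈ φ.source := mem_chart_source _ q
  have hy := extend_mem_target hq
  have hsymm := φ.extend_left_inv (I := 𝓡∂ (n + 1)) hq
  have h0 : I.top (someScale c) q ≠ 0 := fun h0 => hqb (hS ▸ (I.mem_singularSet_iff _ _).2 h0)
  have e1 := ricci_eq_of_isParallel hn hI hφ hy (someScale c) (by rwa [hsymm])
  have e2 := h φ hφ _ hy (by rwa [hsymm])
  have e3 := e1.symm.trans e2
  have hm : I.scale.metric = interiorMetric (someScale c).1 (I.top (someScale c)) := rfl
  have hdet : (comp₂ φ I.scale.metric (φ.extend (𝓡∂ (n + 1)) q)).det ≠ 0 := by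
    rw [hm]
    exact det_comp₂_interiorMetric_ne_zero hφ _ hy (by rwa [hsymm])
  have hne : comp₂ φ I.scale.metric (φ.extend (𝓡∂ (n + 1)) q) ≠ 0 := by
    intro hz
    rw [hz] at hdet
    exact hdet (Matrix.det_zero)
  have e4 := smul_left_injective ℝ hne e3
  rw [hsymm] at e4
  have hn0 : (n : ℝ) ≠ 0 := by positivity
  apply mul_left_cancel₀ hn0
  linear_combination -e4

/-- Up to the choice of a sign, the scale of a unit almost Einstein structure whose singularity set
is the boundary is a special defining function. -/
theorem exists_isPoincareEinstein (hn : 2 ≤ n) {c : ConformalStructure n M} {I : Tractor c}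
    (hI : I.IsParallel) (h : ∀ p, I.normSq p = 1)
    (hS : I.singularSet = (𝓡∂ (n + 1)).boundary M) (g : Scale c) :
    ∃ (x : SmoothFun n M) (τ : Density c 1),
      (∀ g' p, τ.inScale g' p ≠ 0) ∧ τ.metric = g.1.inner ∧
      (∀ g' p, x p = I.scale.inScale g' p / τ.inScale g' p) ∧
      IsPoincareEinstein g.1 x ∧ IsSpecialDefiningFunction g.1 x ∧
      interiorMetric g.1 x = I.scale.metric := by
  have hzero : ∀ p, I.top g p = 0 ↔ p ∈ (𝓡∂ (n + 1)).boundary M := fun p => by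
    rw [← I.mem_singularSet_iff g, hS]
  obtain ⟨s, hs1, hs2⟩ := exists_sign hzero
  have hs0 : ∀ p, s p ≠ 0 := fun p h0 => by simpa [h0] using hs1 p
  -- The density `τ` will be the sign `s` in the scale `g`. As `s² = 1`, it gives back the metric
  -- `g`, and `σ / s = s σ ≥ 0`.
  let x : SmoothFun n M := s * I.top g
  have hx : ∀ p, x p = s p * I.top g p := fun _ => rfl
  have hτ : ∀ (g' : Scale c) (u : SmoothFun n M), IsRescaling g.1 g'.1 u →
      ∀ p, (Density.ofScale 1 g s).inScale g' p = Real.exp (u p) * s p := fun g' u hu p => by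
    rw [Density.ofScale_apply 1 s hu, one_mul]
  have hxzero : ∀ p, x p = 0 ↔ p ∈ (𝓡∂ (n + 1)).boundary M := fun p => by
    rw [hx, ← hzero p, mul_eq_zero, or_iff_right (hs0 p)]
  have hdx : ∀ p ∈ (𝓡∂ (n + 1)).boundary M, cometric g.1 p (dAt x p) (dAt x p) = 1 := by
    intro p hp
    have e := h p
    rw [I.normSq_eq g, (hzero p).2 hp, mul_zero, zero_add, mid_eq_dAt_of_isParallel hI] at e
    -- The derivative of the sign is multiplied by `σ`, which is zero at `p`, so `ds = 0` is not
    -- needed. The zero summand fits the shape of `cometric_add_smul`.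
    have e1 : dAt x p = s p • (dAt (I.top g) p + (0 : ℝ) • dAt s p) := by
      rw [dAt_mul, (hzero p).2 hp, zero_smul, add_zero, add_zero]
    rw [e1, cometric_add_smul, e, hs1]
    ring
  have hmetric : interiorMetric g.1 x = I.scale.metric := by
    funext p
    rw [I.scale.metric_eq g, interiorMetric, hx, mul_pow, hs1, one_mul]
    rfl
  have hdef : IsDefiningFunction x :=
    { nonneg := hs2
      zero_iff := hxzero
      d_ne_zero := fun p hp h0 => by
        have := hdx p hp
        rw [h0] at this
        simp [cometric] at this }
  refine ⟨x, Density.ofScale 1 g s, fun g' p => ?_, ?_, fun g' p => ?_, ⟨hdef, ?_⟩, ⟨hdef, hdx⟩,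
    hmetric⟩
  · obtain ⟨u, hu⟩ := Scale.exists_rescaling g g'
    rw [hτ g' u hu]
    exact mul_ne_zero (Real.exp_pos _).ne' (hs0 p)
  · funext p
    rw [Density.metric_eq _ g, Density.ofScale_self, hs1, inv_one, one_smul]
  · obtain ⟨u, hu⟩ := Scale.exists_rescaling g g'
    rw [hτ g' u hu, hx]
    change _ = I.top g' p / _
    rw [I.transform_top g g' u hu]
    have := hs0 p
    have := (Real.exp_pos (u p)).ne'
    field_simp
    rw [hs1, one_mul]
  · rw [hmetric]
    exact ricciEqOn_of_normSq hn hI hS h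

end

end ConformalGeometry

end

/-! ### The theorem -/

theorem proposition4p3 (n : ℕ) (hn : 3 ≤ n) (M : Type*) [TopologicalSpace M] [T2Space M]
    [CompactSpace M] [ChartedSpace (EuclideanHalfSpace (n + 1)) M]
    [IsManifold (𝓡∂ (n + 1)) ∞ M] :
    -- Poincaré–Einstein manifolds are scalar negative almost Einstein structures
    (∀ (g : Metric n M) (x : SmoothFun n M), IsPoincareEinstein g x →
      ∃ (I : Tractor (conformalClass g)) (τ : Density (conformalClass g) 1),
        (∀ g' p, 0 < τ.inScale g' p) ∧ τ.metric = g.inner ∧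
        (∀ g' p, I.scale.inScale g' p = x p * τ.inScale g' p) ∧
        I.IsAlmostEinstein ∧ I.IsScalarNegative ∧
        (∀ p, I.normSq p = 1) ∧
        I.singularSet = (𝓡∂ (n + 1)).boundary M ∧
        (∀ p ∉ (𝓡∂ (n + 1)).boundary M, I.scale.metric p = interiorMetric g x p) ∧
        IsSpecialDefiningFunction g x) ∧
    -- `|I|² = 1` is equivalent to the normalisation `Ric(g₊) = -n g₊`
    (∀ (c : ConformalStructure n M) (I : Tractor c), I.IsAlmostEinstein →
      I.singularSet = (𝓡∂ (n + 1)).boundary M →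
      ((∀ p, I.normSq p = 1) ↔
        RicciEqOn I.scale.metric (-(n : ℝ)) ((𝓡∂ (n + 1)).boundary M)ᶜ)) ∧
    -- the converse: almost Einstein, `|I|² = 1`, scale singularity set equal to the boundary
    (∀ (c : ConformalStructure n M) (I : Tractor c), I.IsAlmostEinstein →
      (∀ p, I.normSq p = 1) → I.singularSet = (𝓡∂ (n + 1)).boundary M →
      ∀ g : Metric n M, conformalClass g = c →
        ∃ (x : SmoothFun n M) (τ : Density c 1),
          (∀ g' p, τ.inScale g' p ≠ 0) ∧ τ.metric = g.inner ∧
          (∀ g' p, x p = I.scale.inScale g' p / τ.inScale g' p) ∧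
          IsPoincareEinstein g x ∧ IsSpecialDefiningFunction g x ∧
          (∀ p ∉ (𝓡∂ (n + 1)).boundary M, interiorMetric g x p = I.scale.metric p)) := by
  have hn2 : 2 ≤ n := by omega
  refine ⟨fun g x h => ?_, fun c I hI hS => ?_, fun c I hI h hS g hg => ?_⟩
  · obtain ⟨I, hpar, hlen, htop⟩ := exists_tractor_of_isPoincareEinstein hn2 h
    set g₀ : Scale (conformalClass g) := ⟨g, rfl⟩
    have hτ : ∀ g' p, 0 < (Density.ofScale 1 g₀ 1).inScale g' p := by
      intro g' p
      obtain ⟨u, hu⟩ := Scale.exists_rescaling g₀ g'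
      rw [Density.ofScale_apply 1 1 hu]
      exact mul_pos (Real.exp_pos _) one_pos
    -- In the scale `g` itself `τ` is the constant `1`, so the scale of the tractor is represented
    -- by `x`; its zero set and metric are read off there.
    have htop₀ : I.top g₀ = x := by
      ext p
      rw [htop, Density.ofScale_self]
      exact mul_one _
    have hm : I.scale.metric = interiorMetric g x := by
      funext p
      rw [I.scale.metric_eq g₀]
      change ((I.top g₀ p) ^ 2)⁻¹ • _ = _
      rw [htop₀]
      rfl
    have hS : I.singularSet = (𝓡∂ (n + 1)).boundary M := by
      ext p
      rw [I.mem_singularSet_iff g₀, htop₀, h.defining.zero_iff]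
    refine ⟨I, Density.ofScale 1 g₀ 1, hτ, ?_, htop, Tractor.isAlmostEinstein_of_normSq hpar hlen,
      ?_, hlen, hS, fun p _ => congrFun hm p, h.defining,
      fun p hp => cometric_dAt_eq_one_of_isPoincareEinstein hn2 h hp⟩
    · funext p
      rw [Density.metric_eq _ g₀, Density.ofScale_self]
      change ((1 : ℝ) ^ 2)⁻¹ • g.inner p = g.inner p
      simp
    · rw [Tractor.IsScalarNegative, hm, hS]
      exact scalNegOn_interiorMetric hn2
        (fun p hp h0 => hp ((h.defining.zero_iff p).1 h0)) h.einstein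
  · exact ⟨ricciEqOn_of_normSq hn2 hI.1 hS, normSq_of_ricciEqOn hn2 hI.1 hS⟩
  · obtain ⟨x, τ, h1, h2, h3, h4, h5, h6⟩ :=
      exists_isPoincareEinstein hn2 hI.1 h hS ⟨g, hg⟩
    exact ⟨x, τ, h1, h2, h3, h4, h5, fun p _ => congrFun h6 p⟩
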